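/- **Theorem (Duality principle).** Let $G$ be a non-compact semisimple real Lie group with Lie algebra $\mathfrak g$ and a Cartan decomposition $\mathfrak g=\mathfrak k+\mathfrak p$ (that is, $[\mathfrak k,\mathfrak k]\subseteq\mathfrak k$, $[\mathfrak k,\mathfrak p]\subseteq\mathfrak p$, $[\mathfrak p,\mathfrak p]\subseteq\mathfrak k$, and the Killing form is negative definite on $\mathfrak k$ and positive definite on $\mathfrak p$). Let $G$ be a Lie subgroup of a complexification $G^{\mathbb C}$, i.e. of a complex Lie group with Lie algebra $\mathfrak g\oplus i\mathfrak g$, and let $U$ be a compact Lie subgroup of $G^{\mathbb C}$ with Lie algebra $\mathfrak u=\mathfrak k+i\mathfrak p$. Fix $c>0$ and a sign $\varepsilon\in\{1,-1\}$. Equip $U$ with the left-invariant Riemannian metric $-c\,B_{\mathfrak u}$ and $G$ with the left-invariant semi-Riemannian metric $\varepsilon c\,B_{\mathfrak g}$, where $B$ denotes the Killing form. Let $\tau$ denote the Laplace-Beltrami operator, in local coordinates $$\tau(f)=\frac1{\sqrt{|g|}}\sum_{i,j}\frac{\partial}{\partial x_j}\Big(g^{ij}\sqrt{|g|}\,\frac{\partial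 f}{\partial x_i}\Big).$$ For an integer $r\ge 1$, a function $f$ is called proper $r$-harmonic if $\tau^r(f)=0$ and $\tau^{r-1}(f)$ does not vanish identically. Let $f:W\to\mathbb C$ be a real-analytic function on an open subset $W$ of $G$, and let $f^{\mathbb C}:W^{\mathbb C}\to\mathbb C$ be a holomorphic extension of $f$ to an open set $W^{\mathbb C}\subseteq G^{\mathbb C}$ containing $W$, each of whose connected components meets $W$ (so that such an extension to $W^{\mathbb C}$ is unique). The dual function of $f$ is the restriction $f^*:W^*\to\mathbb C$ of $f^{\mathbb C}$ to $W^*=U\cap W^{\mathbb C}$. Then: 1. $\tau(f)$ also extends holomorphically to $W^{\mathbb C}$, and its dual satisfies $\tau(f^*)=-\varepsilon\,(\tau(f))^*$ on $W^*$. 2. If each connected component of $W^{\mathbb C}$ also meets $U$ (for instance if $W^{\mathbb C}$ is connected and $W^*\neq\emptyset$), then for every $r\ge1$ the function $f$ is proper $r$-harmonic on $W$ if and only if $f^*$ is proper $r$-harmonic on $W^*$. -/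

import Mathlib

open scoped Manifold ContDiff

noncomputable section

namespace Duality

section LaplaceBeltrami

variable {n : ℕ} {M : Type*} [TopologicalSpace M] [ChartedSpace (EuclideanSpace ℝ (Fin n)) M]

/-- A field of bilinear forms on the tangent spaces of `M` (a semi-Riemannian metric, when it is
symmetric, non-degenerate and smooth). -/
abbrev MetricField (n : ℕ) (M : Type*) [TopologicalSpace M]
    [ChartedSpace (EuclideanSpace ℝ (Fin n)) M] : Type _ :=
  ∀ x : M, LinearMap.BilinForm ℝ (TangentSpace (𝓡 n) x)

/-- The matrix `(g_ij)` of the metric in the chart `φ`, at the point with coordinates `y`: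
`g_ij = g(∂/∂x_i, ∂/∂x_j)`. -/
def metricMatrix (g : MetricField n M) (φ : OpenPartialHomeomorph M (EuclideanSpace ℝ (Fin n)))
    (y : EuclideanSpace ℝ (Fin n)) : Matrix (Fin n) (Fin n) ℝ :=
  Matrix.of fun i j =>
    g (φ.symm y) (mfderiv (𝓡 n) (𝓡 n) φ.symm y (EuclideanSpace.single i (1 : ℝ)))
      (mfderiv (𝓡 n) (𝓡 n) φ.symm y (EuclideanSpace.single j (1 : ℝ)))

/-- The coordinate expression of the Laplace-Beltrami operator in the chart `φ`:
`|det g|^(-1/2) ∑ i j, ∂_j (g^ij |det g|^(1/2) ∂_i f)`. -/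
def tensionInChart (g : MetricField n M) (φ : OpenPartialHomeomorph M (EuclideanSpace ℝ (Fin n)))
    (f : M → ℂ) (y : EuclideanSpace ℝ (Fin n)) : ℂ :=
  (Real.sqrt |(metricMatrix g φ y).det|)⁻¹ •
    ∑ i, ∑ j,
      fderiv ℝ
        (fun z : EuclideanSpace ℝ (Fin n) =>
          ((metricMatrix g φ z)⁻¹ i j * Real.sqrt |(metricMatrix g φ z).det|) •
            fderiv ℝ (f ∘ φ.symm) z (EuclideanSpace.single i (1 : ℝ)))
        y (EuclideanSpace.single j (1 : ℝ))

/-- The Laplace-Beltrami operator (tension field) `τ` of `(M, g)` acting on complex-valued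
functions, computed at `x` in the preferred chart at `x`. -/
def tension (g : MetricField n M) (f : M → ℂ) (x : M) : ℂ :=
  tensionInChart g (chartAt (EuclideanSpace ℝ (Fin n)) x) f
    (chartAt (EuclideanSpace ℝ (Fin n)) x x)

/-- `f` is proper `r`-harmonic on the open set `W`: `τ^r f = 0` on `W`, and `τ^(r-1) f` does not
vanish identically on `W`. (To be used for `1 ≤ r`.) -/
def IsProperHarmonicOn (g : MetricField n M) (r : ℕ) (f : M → ℂ) (W : Set M) : Prop :=
  (∀ x ∈ W, (tension g)^[r] f x = 0) ∧ ∃ x ∈ W, (tension g)^[r - 1] f x ≠ 0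

end LaplaceBeltrami

section LieGroups

variable {n : ℕ} {G : Type*} [TopologicalSpace G] [ChartedSpace (EuclideanSpace ℝ (Fin n)) G]
  [Group G]

/-- The left-invariant field of bilinear forms whose value at `1` is `B`:
`g_x(v, w) = B(dL_{x⁻¹} v, dL_{x⁻¹} w)`. -/
def leftInvariantMetric (B : LinearMap.BilinForm ℝ (GroupLieAlgebra (𝓡 n) G)) :
    MetricField n G := fun x =>
  B.compl₁₂ (mfderiv (𝓡 n) (𝓡 n) (fun y : G => x⁻¹ * y) x).toLinearMap
    (mfderiv (𝓡 n) (𝓡 n) (fun y : G => x⁻¹ * y) x).toLinearMap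

/-- A Cartan decomposition `𝔤 = 𝔨 + 𝔭` of a real Lie algebra: `[𝔨,𝔨] ⊆ 𝔨`, `[𝔨,𝔭] ⊆ 𝔭`,
`[𝔭,𝔭] ⊆ 𝔨`, and the Killing form is negative definite on `𝔨` and positive definite on `𝔭`. -/
structure IsCartanDecomposition {L : Type*} [LieRing L] [LieAlgebra ℝ L]
    (k : LieSubalgebra ℝ L) (p : Submodule ℝ L) : Prop where
  isCompl : IsCompl k.toSubmodule p
  lie_k_p : ∀ x ∈ k, ∀ y ∈ p, ⁅x, y⁆ ∈ p
  lie_p_p : ∀ x ∈ p, ∀ y ∈ p, ⁅x, y⁆ ∈ k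
  neg_on_k : ∀ x ∈ k, x ≠ 0 → killingForm ℝ L x x < 0
  pos_on_p : ∀ x ∈ p, x ≠ 0 → 0 < killingForm ℝ L x x

variable {GC : Type*} [TopologicalSpace GC] [ChartedSpace (EuclideanSpace ℂ (Fin n)) GC]
  [Group GC]

/-- The differential at the identity of a homomorphism from a real Lie group to a complex Lie
group, as a real-linear map into the complex Lie algebra of the latter. -/
def lieDifferential (φ : G →* GC) :
    GroupLieAlgebra (𝓡 n) G → GroupLieAlgebra 𝓘(ℂ, EuclideanSpace ℂ (Fin n)) GC :=
  fun v => mfderiv (𝓡 n) 𝓘(ℝ, EuclideanSpace ℂ (Fin n)) φ (1 : G) v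

/-- `φ` makes `G` a (real) Lie subgroup of the complex Lie group `GC`: an injective homomorphism
which is a real-analytic immersion. -/
structure IsLieSubgroup (φ : G →* GC) : Prop where
  contMDiff : ContMDiff (𝓡 n) 𝓘(ℝ, EuclideanSpace ℂ (Fin n)) ω φ
  injective : Function.Injective φ
  immersion : Function.Injective (lieDifferential (n := n) φ)

/-- `GC` is a complexification of its Lie subgroup `G`: the Lie algebra of `GC` is
`𝔤 ⊕ i𝔤`, i.e. it is the complexification of `𝔤`. -/
structure IsComplexification (ι : G →* GC) : Prop extends IsLieSubgroup (n := n) ι where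
  bijective : Function.Bijective
    fun x : GroupLieAlgebra (𝓡 n) G × GroupLieAlgebra (𝓡 n) G =>
      lieDifferential (n := n) ι x.1 + Complex.I • lieDifferential (n := n) ι x.2

variable {U : Type*} [TopologicalSpace U] [ChartedSpace (EuclideanSpace ℝ (Fin n)) U] [Group U]

/-- `U` is a Lie subgroup of `GC` with Lie algebra `𝔲 = 𝔨 + i𝔭`. -/
structure IsDualSubgroup [LieGroup (𝓡 n) ω G] (ι : G →* GC)
    (k : LieSubalgebra ℝ (GroupLieAlgebra (𝓡 n) G)) (p : Submodule ℝ (GroupLieAlgebra (𝓡 n) G))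
    (j : U →* GC) : Prop extends IsLieSubgroup (n := n) j where
  range_eq : Set.range (lieDifferential (n := n) j) =
    {z | ∃ x ∈ k, ∃ y ∈ p,
      z = lieDifferential (n := n) ι x + Complex.I • lieDifferential (n := n) ι y}

/-- `F : WC → ℂ` is the holomorphic extension of `f : W → ℂ`. That every connected component of
`WC` meets `W` makes the extension unique. -/
structure IsHolomorphicExtension (ι : G →* GC) (W : Set G) (f : G → ℂ) (WC : Set GC)
    (F : GC → ℂ) : Prop where
  isOpen : IsOpen WC
  subset : W ⊆ ι ⁻¹' WC
  component_meets : ∀ z ∈ WC, (connectedComponentIn WC z ∩ ι '' W).Nonempty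
  holomorphic : ContMDiffOn 𝓘(ℂ, EuclideanSpace ℂ (Fin n)) 𝓘(ℂ) ω F WC
  eq_on : ∀ x ∈ W, F (ι x) = f x

end LieGroups

end Duality

end

namespace Duality

open Set Filter Topology VectorField

/-! Both Laplacians are restrictions of one holomorphic differential operator on the complex group.
A Lie algebra with nondegenerate Killing form satisfies tr ad = 0, so its left-invariant fields X_a
are divergence free for the left-invariant volume. For a nondegenerate left-invariant metric with
value B at the identity, the coordinate formula then collapses to τ = ∑ B^{ab} X_b X_a
(`tension_leftInvariantMetric`).

On G^ℂ the same expression for the complex Killing form is `casimir`, which is independent of the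
basis and preserves holomorphy. Let φ be either inclusion. Its differential preserves brackets and
sends a real basis to a complex one, because 𝔤 and 𝔲 = 𝔨 + i𝔭 both span 𝔤^ℂ over ℂ. The structure
constants are unchanged, so the real Killing matrix is also the complex one in the image basis.
Moreover, differentiating F∘φ along v amounts to differentiating F along dφ(v) when F is
holomorphic. Hence the metric α·(Killing form) gives τ(F∘φ) = α⁻¹ (`casimir` F)∘φ
(`IsLieSubgroup.tension_eq_casimir`). The values α = εc on G and α = -c on U differ by the factor
-ε, which is part 1.

Part 2 rests on an identity theorem: a holomorphic function that vanishes on an open piece of a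
subgroup spanning 𝔤^ℂ has zero Taylor series there, so it vanishes on every component of the domain
meeting that piece (`IsLieSubgroup.eqOn_zero`). Proper r-harmonicity on either side thus becomes the
same statement about iterates of `casimir` on W^ℂ (`IsLieSubgroup.isProperHarmonicOn_iff`). -/

theorem tendsto_mul_left_nhds {G : Type*} [TopologicalSpace G] [Group G] [ContinuousMul G]
    (g : G) : Tendsto (fun h : G => g * h) (𝓝 1) (𝓝 g) := by
  simpa using (continuous_const_mul g).tendsto (1 : G)

/-! ### Left-invariant derivatives and the left-invariant frame in a chart -/

section InvariantDerivative

variable {𝕜 : Type*} [NontriviallyNormedField 𝕜]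
  {E : Type*} [NormedAddCommGroup E] [NormedSpace 𝕜 E]
  {G : Type*} [TopologicalSpace G] [ChartedSpace E G] [Group G]
  {H : Type*} [NormedAddCommGroup H] [NormedSpace 𝕜 H]

/-- The derivative of `f` at `g` along the left-invariant vector field with value `v` at `1`. -/
noncomputable def invDeriv (v : GroupLieAlgebra 𝓘(𝕜, E) G) (f : G → H) (g : G) : H :=
  mfderiv 𝓘(𝕜, E) 𝓘(𝕜, H) (fun h => f (g * h)) 1 v

variable (𝕜) in
/-- The left-invariant vector fields in the chart `ψ`. -/
noncomputable def chartFrame (ψ : OpenPartialHomeomorph G E) (z : E) :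
    E →L[𝕜] E :=
  mfderiv 𝓘(𝕜, E) 𝓘(𝕜, E) (fun h => ψ (ψ.symm z * h)) (1 : G)

variable (𝕜) in
/-- The inverse of `chartFrame`: the left-invariant Maurer-Cartan form in the chart `ψ`. -/
noncomputable def chartCoframe (ψ : OpenPartialHomeomorph G E) (z : E) : E →L[𝕜] E :=
  (mfderiv 𝓘(𝕜, E) 𝓘(𝕜, E) (fun y => (ψ.symm z)⁻¹ * y) (ψ.symm z)).comp
    (mfderiv 𝓘(𝕜, E) 𝓘(𝕜, E) ψ.symm z)

variable [LieGroup 𝓘(𝕜, E) ω G]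

theorem contMDiff_mul_left_self (g : G) : ContMDiff 𝓘(𝕜, E) 𝓘(𝕜, E) ω (fun h : G => g * h) :=
  contMDiff_mul_left

theorem invDeriv_congr {v : GroupLieAlgebra 𝓘(𝕜, E) G} {f₁ f₂ : G → H} {g : G}
    (h : f₁ =ᶠ[𝓝 g] f₂) : invDeriv v f₁ g = invDeriv v f₂ g := by
  have h' : (fun h => f₁ (g * h)) =ᶠ[𝓝 1] (fun h => f₂ (g * h)) :=
    haveI := continuousMul_of_contMDiffMul 𝓘(𝕜, E) ω (G := G)
    (tendsto_mul_left_nhds g).eventually h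
  simp only [invDeriv]
  rw [h'.mfderiv_eq]
  rfl

theorem contMDiffAt_comp_mul_left {f : G → H} {g : G}
    (hf : ContMDiffAt 𝓘(𝕜, E) 𝓘(𝕜, H) ω f g) :
    ContMDiffAt 𝓘(𝕜, E) 𝓘(𝕜, H) ω (fun h => f (g * h)) 1 := by
  have : ContMDiffAt 𝓘(𝕜, E) 𝓘(𝕜, H) ω f (g * 1) := by simpa using hf
  exact this.comp (1 : G) (contMDiff_mul_left_self (𝕜 := 𝕜) (E := E) g).contMDiffAt

variable {x₀ : G}

local notation "ψ" => chartAt E x₀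

theorem contMDiffAt_chart_of_mem {g : G} (hg : g ∈ (ψ).source) :
    ContMDiffAt 𝓘(𝕜, E) 𝓘(𝕜, E) ω ψ g :=
  contMDiffOn_chart.contMDiffAt ((ψ).open_source.mem_nhds hg)

theorem contMDiffAt_chart_symm_of_mem {z : E} (hz : z ∈ (ψ).target) :
    ContMDiffAt 𝓘(𝕜, E) 𝓘(𝕜, E) ω (ψ).symm z :=
  contMDiffOn_chart_symm.contMDiffAt ((ψ).open_target.mem_nhds hz)

theorem contDiffAt_comp_chart_symm {f : G → H} {z : E} (hz : z ∈ (ψ).target)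
    (hf : ContMDiffAt 𝓘(𝕜, E) 𝓘(𝕜, H) ω f ((ψ).symm z)) :
    ContDiffAt 𝕜 ω (f ∘ (ψ).symm) z := by
  rw [← contMDiffAt_iff_contDiffAt]
  exact hf.comp z (contMDiffAt_chart_symm_of_mem hz)

theorem contMDiffAt_of_comp_chart_symm {f : G → H} {g : G} (hg : g ∈ (ψ).source)
    (hf : ContDiffAt 𝕜 ω (f ∘ (ψ).symm) (ψ g)) :
    ContMDiffAt 𝓘(𝕜, E) 𝓘(𝕜, H) ω f g := by
  have h := ContMDiffAt.comp g (contMDiffAt_iff_contDiffAt.2 hf)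
    (contMDiffAt_chart_of_mem (𝕜 := 𝕜) hg)
  refine h.congr_of_eventuallyEq ?_
  filter_upwards [(ψ).open_source.mem_nhds hg] with y hy
  simp [(ψ).left_inv hy]

theorem contMDiffAt_chart_mul {z : E} (hz : z ∈ (ψ).target) :
    ContMDiffAt 𝓘(𝕜, E) 𝓘(𝕜, E) ω (fun h => ψ ((ψ).symm z * h)) (1 : G) :=
  contMDiffAt_comp_mul_left (contMDiffAt_chart_of_mem ((ψ).map_target hz))

theorem invDeriv_chart_symm {f : G → H} {z : E} (hz : z ∈ (ψ).target)
    (hf : ContMDiffAt 𝓘(𝕜, E) 𝓘(𝕜, H) ω f ((ψ).symm z)) (v : GroupLieAlgebra 𝓘(𝕜, E) G) :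
    invDeriv v f ((ψ).symm z) = fderiv 𝕜 (f ∘ (ψ).symm) z (chartFrame 𝕜 ψ z v) := by
  have h1 := (contDiffAt_comp_chart_symm hz hf).differentiableAt (by simp)
  have h1' : HasMFDerivAt 𝓘(𝕜, E) 𝓘(𝕜, H) (f ∘ (ψ).symm) (ψ ((ψ).symm z * 1))
      (fderiv 𝕜 (f ∘ (ψ).symm) z) := by
    rw [mul_one, (ψ).right_inv hz]
    exact h1.hasFDerivAt.hasMFDerivAt
  have h2 := ((contMDiffAt_chart_mul (𝕜 := 𝕜) hz).mdifferentiableAt (by simp)).hasMFDerivAt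
  have h3 := HasMFDerivAt.comp (1 : G) h1' h2
  have := continuousMul_of_contMDiffMul 𝓘(𝕜, E) ω (G := G)
  have hc := tendsto_mul_left_nhds ((ψ).symm z)
  have h4 : (fun h => f ((ψ).symm z * h)) =ᶠ[𝓝 1]
      (f ∘ (ψ).symm) ∘ (fun h => ψ ((ψ).symm z * h)) := by
    filter_upwards [hc.eventually ((ψ).open_source.mem_nhds ((ψ).map_target hz))] with h hh
    simp [(ψ).left_inv hh]
  rw [invDeriv, (h3.congr_of_eventuallyEq h4).mfderiv]
  rfl

/-- The frame is the partial derivative, in the second variable, of multiplication read in charts,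
and multiplication is jointly analytic. -/
theorem contDiffAt_chartFrame {z : E} (hz : z ∈ (ψ).target) :
    ContDiffAt 𝕜 ω (chartFrame 𝕜 ψ) z := by
  let χ := chartAt E (1 : G)
  let m : E → E → E := fun y t => ψ ((ψ).symm y * χ.symm t)
  have hχ : χ 1 ∈ χ.target := mem_chart_target E 1
  have hχ1 : χ.symm (χ 1) = 1 := χ.left_inv (mem_chart_source E 1)
  have hm : ContDiffAt 𝕜 ω (Function.uncurry m) (z, χ 1) := by
    rw [← contMDiffAt_iff_contDiffAt]
    have h1 : ContMDiffAt 𝓘(𝕜, E × E) 𝓘(𝕜, E) ω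
        (fun q : E × E => (ψ).symm q.1 * χ.symm q.2) (z, χ 1) :=
      ((contMDiffAt_chart_symm_of_mem hz).comp (z, χ 1) contDiffAt_fst.contMDiffAt).mul
        ((contMDiffAt_chart_symm_of_mem hχ).comp (z, χ 1) contDiffAt_snd.contMDiffAt)
    refine ContMDiffAt.comp (z, χ 1) (g := ψ) (contMDiffAt_chart_of_mem ?_) h1
    simpa [hχ1] using (ψ).map_target hz
  have h2 : ContDiffAt 𝕜 ω (fun y => fderiv 𝕜 (m y) (χ 1)) z :=
    ContDiffAt.fderiv (f := m) (n := ω) hm contDiffAt_const (by simp)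
  refine h2.congr_of_eventuallyEq ?_
  filter_upwards [(ψ).open_target.mem_nhds hz] with y hy
  have hd := (contMDiffAt_chart_mul (𝕜 := 𝕜) hy).mdifferentiableAt (n := ω) (by simp)
  refine (if_pos hd).trans ?_
  simp only [writtenInExtChartAt, m, χ, Function.comp_def, mfld_simps, fderivWithin_univ]
  rfl

theorem invDeriv_comp_chart_symm {f : G → H} {z : E} (hz : z ∈ (ψ).target)
    (hf : ContMDiffAt 𝓘(𝕜, E) 𝓘(𝕜, H) ω f ((ψ).symm z)) (v : GroupLieAlgebra 𝓘(𝕜, E) G) :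
    invDeriv v f ∘ (ψ).symm =ᶠ[𝓝 z]
      fun y => fderiv 𝕜 (f ∘ (ψ).symm) y (chartFrame 𝕜 ψ y v) := by
  have h1 : ∀ᶠ y in 𝓝 ((ψ).symm z), ContMDiffAt 𝓘(𝕜, E) 𝓘(𝕜, H) ω f y :=
    haveI : IsManifold 𝓘(𝕜, E) ω G := inferInstance
    (contMDiffAt_iff_contMDiffAt_nhds (by simp)).1 hf
  have h2 := ((ψ).continuousAt_symm hz).eventually h1
  filter_upwards [(ψ).open_target.mem_nhds hz, h2] with y hy hy2
  exact invDeriv_chart_symm hy hy2 v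

theorem contMDiffAt_invDeriv {f : G → H} {g : G} (hf : ContMDiffAt 𝓘(𝕜, E) 𝓘(𝕜, H) ω f g)
    (v : GroupLieAlgebra 𝓘(𝕜, E) G) :
    ContMDiffAt 𝓘(𝕜, E) 𝓘(𝕜, H) ω (invDeriv v f) g := by
  have hg := mem_chart_source E g
  have hg' := (chartAt E g).map_source hg
  have hf' : ContMDiffAt 𝓘(𝕜, E) 𝓘(𝕜, H) ω f ((chartAt E g).symm (chartAt E g g)) := by
    rwa [(chartAt E g).left_inv hg]
  refine contMDiffAt_of_comp_chart_symm hg ?_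
  refine ContDiffAt.congr_of_eventuallyEq ?_ (invDeriv_comp_chart_symm hg' hf' v)
  exact ((contDiffAt_comp_chart_symm hg' hf').fderiv_right (m := ω) (by simp)).clm_apply
    ((contDiffAt_chartFrame hg').clm_apply contDiffAt_const)

theorem mfderiv_chart_symm_chartFrame {z : E} (hz : z ∈ (ψ).target)
    (u : GroupLieAlgebra 𝓘(𝕜, E) G) :
    mfderiv 𝓘(𝕜, E) 𝓘(𝕜, E) (ψ).symm z (chartFrame 𝕜 ψ z u) =
      mulInvariantVectorField u ((ψ).symm z) := by
  set g := (ψ).symm z with hg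
  have h0 : HasMFDerivAt 𝓘(𝕜, E) 𝓘(𝕜, E) (fun h => ψ (g * h)) (1 : G)
      (chartFrame (E := E) 𝕜 ψ z) :=
    ((contMDiffAt_chart_mul (𝕜 := 𝕜) hz).mdifferentiableAt (by simp)).hasMFDerivAt
  have e1 : ψ (g * 1) = z := by rw [mul_one, hg, (ψ).right_inv hz]
  have h1 : HasMFDerivAt 𝓘(𝕜, E) 𝓘(𝕜, E) (ψ).symm (ψ (g * 1))
      (mfderiv 𝓘(𝕜, E) 𝓘(𝕜, E) (ψ).symm z) := by
    rw [e1]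
    exact ((contMDiffAt_chart_symm_of_mem (𝕜 := 𝕜) hz).mdifferentiableAt (by simp)).hasMFDerivAt
  have h3 := HasMFDerivAt.comp (1 : G) h1 h0
  have := continuousMul_of_contMDiffMul 𝓘(𝕜, E) ω (G := G)
  have hc := tendsto_mul_left_nhds g
  have h4 : (fun h : G => g * h) =ᶠ[𝓝 1] (ψ).symm ∘ (fun h => ψ (g * h)) := by
    filter_upwards [hc.eventually ((ψ).open_source.mem_nhds ((ψ).map_target hz))] with h hh
    simp [(ψ).left_inv hh]
  exact (DFunLike.congr_fun (h3.congr_of_eventuallyEq h4).mfderiv u).symm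

/-- The frame is dL_g and the coframe dL_{g⁻¹}, both read in the chart; their composite is the
differential of L_{g⁻¹} ∘ L_g = id. -/
theorem chartFrame_leftInverse {z : E} (hz : z ∈ (ψ).target) (w : E) :
    chartCoframe 𝕜 ψ z (chartFrame 𝕜 ψ z w) = w := by
  set g := (ψ).symm z with hg
  have h1 : HasMFDerivAt 𝓘(𝕜, E) 𝓘(𝕜, E) (fun y : G => g * y) 1
      (mfderiv 𝓘(𝕜, E) 𝓘(𝕜, E) (fun y : G => g * y) 1) :=
    ((contMDiff_mul_left_self (𝕜 := 𝕜) (E := E) g).mdifferentiableAt (by simp)).hasMFDerivAt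
  have h2 : HasMFDerivAt 𝓘(𝕜, E) 𝓘(𝕜, E) (fun y => g⁻¹ * y) (g * 1)
      (mfderiv 𝓘(𝕜, E) 𝓘(𝕜, E) (fun y => g⁻¹ * y) g) := by
    rw [mul_one]
    exact ((contMDiff_mul_left_self (𝕜 := 𝕜) (E := E) g⁻¹).mdifferentiableAt
      (by simp)).hasMFDerivAt
  have h3 := (HasMFDerivAt.comp (1 : G) h2 h1).mfderiv
  have h4 : (fun y => g⁻¹ * y) ∘ (fun y : G => g * y) = id := by ext; simp
  rw [h4, mfderiv_id] at h3
  have h5 := congrArg (mfderiv 𝓘(𝕜, E) 𝓘(𝕜, E) (fun y => g⁻¹ * y) g)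
    (mfderiv_chart_symm_chartFrame hz w)
  exact h5.trans (DFunLike.congr_fun h3 w).symm

theorem chartFrame_injective {z : E} (hz : z ∈ (ψ).target) :
    Function.Injective (chartFrame 𝕜 ψ z) :=
  Function.LeftInverse.injective (g := chartCoframe 𝕜 ψ z) (chartFrame_leftInverse hz)

theorem chartFrame_rightInverse [FiniteDimensional 𝕜 E] {z : E} (hz : z ∈ (ψ).target) (w : E) :
    chartFrame 𝕜 ψ z (chartCoframe 𝕜 ψ z w) = w := by
  obtain ⟨u, hu⟩ := LinearMap.surjective_of_injective
    (f := (chartFrame 𝕜 ψ z).toLinearMap) (chartFrame_injective hz) w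
  have hu : chartFrame 𝕜 ψ z u = w := hu
  rw [← hu]
  exact congrArg _ (chartFrame_leftInverse hz u)

/-- In the chart, the left-invariant fields are pullbacks under the inverse chart, and pullback
commutes with brackets of vector fields. -/
theorem chart_lieBracket [IsRCLikeNormedField 𝕜] [CompleteSpace E]
    {z : E} (hz : z ∈ (ψ).target)
    (v w : GroupLieAlgebra 𝓘(𝕜, E) G) :
    lieBracket 𝕜 (fun y => chartFrame 𝕜 ψ y v) (fun y => chartFrame 𝕜 ψ y w) z =
      chartFrame 𝕜 ψ z (⁅v, w⁆ : GroupLieAlgebra 𝓘(𝕜, E) G) := by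
  have key : ∀ u : GroupLieAlgebra 𝓘(𝕜, E) G, ∀ y ∈ (ψ).target,
      mpullback 𝓘(𝕜, E) 𝓘(𝕜, E) (ψ).symm (mulInvariantVectorField u) y
        = chartFrame 𝕜 ψ y u := by
    intro u y hy
    have hinv : (mfderiv 𝓘(𝕜, E) 𝓘(𝕜, E) (ψ).symm y).IsInvertible :=
      ⟨(mdifferentiable_chart x₀).symm.mfderiv hy, rfl⟩
    rw [mpullback_apply]
    exact hinv.inverse_apply_eq.2 (mfderiv_chart_symm_chartFrame hy u).symm
  have h1 := mpullback_mlieBracket (I := 𝓘(𝕜, E)) (I' := 𝓘(𝕜, E)) (f := (ψ).symm) (x₀ := z)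
    (n := ω) (mdifferentiableAt_mulInvariantVectorField v)
    (mdifferentiableAt_mulInvariantVectorField w) (contMDiffAt_chart_symm_of_mem hz) (by simp)
  rw [← mulInvariantVector_mlieBracket, key _ z hz] at h1
  refine Eq.trans ?_ h1.symm
  rw [← mlieBracketWithin_univ, mlieBracketWithin_eq_lieBracketWithin]
  refine Eq.trans ?_ (congrFun lieBracketWithin_univ.symm z)
  refine (Filter.EventuallyEq.lieBracket_vectorField_eq ?_ ?_).symm
  · filter_upwards [(ψ).open_target.mem_nhds hz] with y hy using key v y hy
  · filter_upwards [(ψ).open_target.mem_nhds hz] with y hy using key w y hy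

end InvariantDerivative

/-! ### Linearity of invariant derivatives and their commutators -/

section InvariantDerivativeAlgebra

variable {𝕜 : Type*} [NontriviallyNormedField 𝕜]
  {E : Type*} [NormedAddCommGroup E] [NormedSpace 𝕜 E]
  {G : Type*} [TopologicalSpace G] [ChartedSpace E G] [Group G]
  {H : Type*} [NormedAddCommGroup H] [NormedSpace 𝕜 H]

theorem invDeriv_sum_smul {ι : Type*} (s : Finset ι) (c : ι → 𝕜)
    (v : ι → GroupLieAlgebra 𝓘(𝕜, E) G) (f : G → H) (g : G) :
    invDeriv (∑ i ∈ s, c i • v i) f g = ∑ i ∈ s, c i • invDeriv (v i) f g := by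
  refine (map_sum (mfderiv 𝓘(𝕜, E) 𝓘(𝕜, H) (fun h => f (g * h)) 1) _ s).trans ?_
  exact Finset.sum_congr rfl fun i _ => map_smul _ _ _

theorem invDeriv_smul_left (c : 𝕜) (v : GroupLieAlgebra 𝓘(𝕜, E) G) (f : G → H) (g : G) :
    invDeriv (c • v) f g = c • invDeriv v f g :=
  map_smul (mfderiv 𝓘(𝕜, E) 𝓘(𝕜, H) (fun h => f (g * h)) 1) c v

variable [LieGroup 𝓘(𝕜, E) ω G]

theorem invDeriv_fun_sum_smul {ι : Type*} (s : Finset ι) (c : ι → 𝕜)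
    (v : GroupLieAlgebra 𝓘(𝕜, E) G) (f : ι → G → H) (g : G)
    (hf : ∀ i ∈ s, ContMDiffAt 𝓘(𝕜, E) 𝓘(𝕜, H) ω (f i) g) :
    invDeriv v (fun x => ∑ i ∈ s, c i • f i x) g = ∑ i ∈ s, c i • invDeriv v (f i) g := by
  have h1 : ∀ i ∈ s, HasMFDerivAt 𝓘(𝕜, E) 𝓘(𝕜, H) (fun h => f i (g * h)) (1 : G)
      (mfderiv 𝓘(𝕜, E) 𝓘(𝕜, H) (fun h => f i (g * h)) 1) := fun i hi =>
    ((contMDiffAt_comp_mul_left (hf i hi)).mdifferentiableAt (by simp)).hasMFDerivAt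
  have h2 : HasMFDerivAt 𝓘(𝕜, E) 𝓘(𝕜, H) (fun h => ∑ i ∈ s, c i • f i (g * h)) (1 : G)
      (∑ i ∈ s, c i • (mfderiv 𝓘(𝕜, E) 𝓘(𝕜, H) (fun h => f i (g * h)) 1 : E →L[𝕜] H)) := by
    refine ⟨?_, ?_⟩
    · exact tendsto_finsetSum _ fun i hi => ((h1 i hi).1.const_smul (c i))
    · have := HasFDerivWithinAt.fun_sum (u := s) fun i hi => (h1 i hi).2.const_smul (c i)
      exact this
  rw [invDeriv, h2.mfderiv]
  exact _root_.sum_apply (F := E →L[𝕜] H) _ _ _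

/-- In a chart this is the identity L_{[X,Y]} = L_X L_Y - L_Y L_X, which comes from the symmetry of
second derivatives. -/
theorem invDeriv_lie [IsRCLikeNormedField 𝕜] [CompleteSpace E] {f : G → H} {g : G}
    (hf : ContMDiffAt 𝓘(𝕜, E) 𝓘(𝕜, H) ω f g) (v w : GroupLieAlgebra 𝓘(𝕜, E) G) :
    invDeriv ⁅v, w⁆ f g = invDeriv v (invDeriv w f) g - invDeriv w (invDeriv v f) g := by
  set z := chartAt E g g with hz
  have hzt : z ∈ (chartAt E g).target := mem_chart_target E g
  have hg : (chartAt E g).symm z = g := (chartAt E g).left_inv (mem_chart_source E g)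
  have hf' : ContMDiffAt 𝓘(𝕜, E) 𝓘(𝕜, H) ω f ((chartAt E g).symm z) := by rwa [hg]
  have key : ∀ u u' : GroupLieAlgebra 𝓘(𝕜, E) G, invDeriv u (invDeriv u' f) g =
      fderiv 𝕜 (fun y => fderiv 𝕜 (f ∘ (chartAt E g).symm) y (chartFrame 𝕜 (chartAt E g) y u')) z
        (chartFrame 𝕜 (chartAt E g) z u) := by
    intro u u'
    have h1 := invDeriv_chart_symm hzt (contMDiffAt_invDeriv hf' u') u
    rw [(invDeriv_comp_chart_symm hzt hf' u').fderiv_eq, hg] at h1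
    exact h1
  have hA : ∀ u : E, DifferentiableAt 𝕜 (fun y => chartFrame 𝕜 (chartAt E g) y u) z := fun u =>
    ((contDiffAt_chartFrame hzt).clm_apply contDiffAt_const).differentiableAt (by simp)
  have h2 := fderiv_apply_lieBracket (contDiffAt_comp_chart_symm hzt hf') (by simp) (hA w) (hA v)
  rw [key, key, ← h2, chart_lieBracket hzt, ← invDeriv_chart_symm hzt hf', hg]

end InvariantDerivativeAlgebra

/-! ### Complex smoothness and derivatives viewed over ℝ -/

section RestrictScalars

variable {E : Type*} [NormedAddCommGroup E] [NormedSpace ℂ E] [NormedSpace ℝ E]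
  [IsScalarTower ℝ ℂ E]
  {M : Type*} [TopologicalSpace M] [ChartedSpace E M]
  {H : Type*} [NormedAddCommGroup H] [NormedSpace ℂ H] [NormedSpace ℝ H] [IsScalarTower ℝ ℂ H]

theorem _root_.ContMDiffAt.restrictScalars_real {f : M → H} {x : M}
    (hf : ContMDiffAt 𝓘(ℂ, E) 𝓘(ℂ, H) ω f x) : ContMDiffAt 𝓘(ℝ, E) 𝓘(ℝ, H) ω f x := by
  rw [contMDiffAt_iff] at hf ⊢
  exact ⟨hf.1, hf.2.restrict_scalars ℝ⟩

theorem _root_.HasMFDerivAt.restrictScalars_real {f : M → H} {x : M} {f' : E →L[ℂ] H}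
    (hf : HasMFDerivAt 𝓘(ℂ, E) 𝓘(ℂ, H) f x f') :
    HasMFDerivAt 𝓘(ℝ, E) 𝓘(ℝ, H) f x (f'.restrictScalars ℝ) :=
  ⟨hf.1, hf.2.restrictScalars ℝ⟩

end RestrictScalars

/-! ### Naturality of invariant derivatives and brackets under a homomorphism -/

section Naturality

variable {n : ℕ}
  {G : Type*} [TopologicalSpace G] [ChartedSpace (EuclideanSpace ℝ (Fin n)) G] [Group G]
  {GC : Type*} [TopologicalSpace GC] [ChartedSpace (EuclideanSpace ℂ (Fin n)) GC] [Group GC]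
  {H : Type*} [NormedAddCommGroup H] [NormedSpace ℂ H] [NormedSpace ℝ H] [IsScalarTower ℝ ℂ H]

theorem IsLieSubgroup.contMDiffAt_comp {φ : G →* GC} (hφ : IsLieSubgroup (n := n) φ)
    {F : GC → H} {g : G}
    (hF : ContMDiffAt 𝓘(ℂ, EuclideanSpace ℂ (Fin n)) 𝓘(ℂ, H) ω F (φ g)) :
    ContMDiffAt (𝓡 n) 𝓘(ℝ, H) ω (F ∘ φ) g :=
  hF.restrictScalars_real.comp g hφ.contMDiff.contMDiffAt

variable [LieGroup 𝓘(ℂ, EuclideanSpace ℂ (Fin n)) ω GC]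

/-- Since φ ∘ L_g = L_{φ g} ∘ φ, this is the chain rule at the identity. Holomorphy of F makes the
derivative on the right complex linear in its direction. -/
theorem IsLieSubgroup.invDeriv_comp {φ : G →* GC} (hφ : IsLieSubgroup (n := n) φ)
    {F : GC → H} {g : G}
    (hF : ContMDiffAt 𝓘(ℂ, EuclideanSpace ℂ (Fin n)) 𝓘(ℂ, H) ω F (φ g))
    (v : GroupLieAlgebra (𝓡 n) G) :
    invDeriv v (F ∘ φ) g = invDeriv (lieDifferential (n := n) φ v) F (φ g) := by
  let E := EuclideanSpace ℂ (Fin n)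
  obtain ⟨D, hD⟩ : ∃ D : E →L[ℂ] H,
      mfderiv 𝓘(ℂ, E) 𝓘(ℂ, H) (fun h => F (φ g * h)) (1 : GC) = D := ⟨_, rfl⟩
  have h1 : HasMFDerivAt 𝓘(ℂ, E) 𝓘(ℂ, H) (fun h => F (φ g * h)) (1 : GC) D :=
    hD ▸ ((contMDiffAt_comp_mul_left hF).mdifferentiableAt (by simp)).hasMFDerivAt
  have h1' : HasMFDerivAt 𝓘(ℝ, E) 𝓘(ℝ, H) (fun h => F (φ g * h)) (φ 1)
      (D.restrictScalars ℝ) := by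
    rw [map_one]
    exact h1.restrictScalars_real
  have h2 := (hφ.contMDiff.mdifferentiableAt (by simp) (x := 1)).hasMFDerivAt
  have h3 := (HasMFDerivAt.comp (1 : G) h1' h2).mfderiv
  have h4 : (fun h => F (φ g * h)) ∘ φ = fun h => (F ∘ φ) (g * h) := by
    ext h; simp
  rw [h4] at h3
  have h5 := DFunLike.congr_fun h3 v
  refine h5.trans ?_
  rw [invDeriv, hD]
  rfl

/-- Both sides act on a function as a commutator of invariant derivatives, and these commute with
restriction along φ. Testing on a chart at 1 suffices, since its differential there is injective. -/
theorem IsLieSubgroup.lieDifferential_lie [LieGroup (𝓡 n) ω G] {φ : G →* GC}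
    (hφ : IsLieSubgroup (n := n) φ) (v w : GroupLieAlgebra (𝓡 n) G) :
    lieDifferential (n := n) φ ⁅v, w⁆ =
      ⁅lieDifferential (n := n) φ v, lieDifferential (n := n) φ w⁆ := by
  let E := EuclideanSpace ℂ (Fin n)
  let F : GC → E := chartAt E (1 : GC)
  have hF : ContMDiffAt 𝓘(ℂ, E) 𝓘(ℂ, E) ω F (φ 1) := by
    rw [map_one]
    exact contMDiffAt_chart_of_mem (mem_chart_source E 1)
  have hev : ∀ u : GroupLieAlgebra (𝓡 n) G, invDeriv u (F ∘ φ) =ᶠ[𝓝 1]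
      invDeriv (lieDifferential (n := n) φ u) F ∘ φ := by
    intro u
    have h1 : ∀ᶠ y in 𝓝 (φ 1), ContMDiffAt 𝓘(ℂ, E) 𝓘(ℂ, E) ω F y :=
      (contMDiffAt_iff_contMDiffAt_nhds (by simp)).1 hF
    filter_upwards [hφ.contMDiff.continuous.continuousAt.eventually h1] with y hy
    exact hφ.invDeriv_comp hy u
  have h2 : ∀ u u' : GroupLieAlgebra (𝓡 n) G, invDeriv u (invDeriv u' (F ∘ φ)) 1 =
      invDeriv (lieDifferential (n := n) φ u)
        (invDeriv (lieDifferential (n := n) φ u') F) (φ 1) := by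
    intro u u'
    rw [invDeriv_congr (hev u'), hφ.invDeriv_comp (contMDiffAt_invDeriv hF _)]
  have h3 := invDeriv_lie (hφ.contMDiffAt_comp hF) v w
  rw [hφ.invDeriv_comp hF, h2, h2, ← invDeriv_lie hF] at h3
  have h4 : ∀ u : GroupLieAlgebra 𝓘(ℂ, E) GC,
      invDeriv u F (φ 1) = chartFrame ℂ (chartAt E (1 : GC)) (chartAt E (1 : GC) 1) u := by
    -- The type of the derivative involves the base point, so the equality of base points is
    -- transported by substitution instead of rewriting.
    have : ∀ a b : GC, a = b → ∀ u : E, (mfderiv 𝓘(ℂ, E) 𝓘(ℂ, E) (fun h => F (a * h)) 1 : E →L[ℂ] E) u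
        = (mfderiv 𝓘(ℂ, E) 𝓘(ℂ, E) (fun h => F (b * h)) 1 : E →L[ℂ] E) u := by
      rintro a b rfl u
      rfl
    refine this _ _ ?_
    rw [map_one, (chartAt E (1 : GC)).left_inv (mem_chart_source E 1)]
  rw [h4, h4] at h3
  exact chartFrame_injective (mem_chart_target E 1) h3

end Naturality

/-! ### The identity theorem on complex manifolds -/

section IdentityTheorem

theorem _root_.AnalyticAt.eventually_eq_zero_of_iteratedFDeriv {E H : Type*}
    [NormedAddCommGroup E] [NormedSpace ℂ E] [NormedAddCommGroup H] [NormedSpace ℂ H]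
    [CompleteSpace H] {f : E → H} {z : E} (hf : AnalyticAt ℂ f z)
    (h : ∀ k : ℕ, iteratedFDeriv ℂ k f z = 0) : f =ᶠ[𝓝 z] 0 := by
  obtain ⟨q, r, hq⟩ := hf
  filter_upwards [Metric.eball_mem_nhds z hq.r_pos] with y hy
  have hy' : y - z ∈ Metric.eball (0 : E) r := by
    simpa [edist_eq_enorm_sub] using hy
  have h1 := hq.hasSum_iteratedFDeriv hy'
  simp only [h, zero_apply, smul_zero, add_sub_cancel] at h1
  exact h1.unique hasSum_zero

variable {E : Type*} [NormedAddCommGroup E] [NormedSpace ℂ E]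
  {M : Type*} [TopologicalSpace M] [ChartedSpace E M] [IsManifold 𝓘(ℂ, E) ω M]
  {H : Type*} [NormedAddCommGroup H] [NormedSpace ℂ H]

/-- The set of points near which F vanishes is open. It is also relatively closed in C: a chart ball
around a limit point contains a point of the set, and the identity theorem on that ball propagates
the vanishing to its centre. -/
theorem _root_.IsPreconnected.eventuallyEq_zero_of_holomorphic {C U : Set M}
    (hC : IsPreconnected C) (hU : IsOpen U) (hCU : C ⊆ U) {F : M → H}
    (hF : ContMDiffOn 𝓘(ℂ, E) 𝓘(ℂ, H) ω F U) {z₀ : M} (hz₀ : z₀ ∈ C) (h₀ : F =ᶠ[𝓝 z₀] 0) :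
    ∀ z ∈ C, F =ᶠ[𝓝 z] 0 := by
  have hopen : IsOpen {z | F =ᶠ[𝓝 z] 0} := isOpen_setOfPred_eventually_nhds
  refine hC.subset_of_closure_inter_subset hopen ⟨z₀, hz₀, h₀⟩ ?_
  rintro z ⟨hzc, hzC⟩
  set ψ := chartAt E z
  have hψ : z ∈ ψ.source := mem_chart_source E z
  have hO : IsOpen (ψ.target ∩ ψ.symm ⁻¹' U) := ψ.isOpen_inter_preimage_symm hU
  have hzO : ψ z ∈ ψ.target ∩ ψ.symm ⁻¹' U :=
    ⟨ψ.map_source hψ, by simpa [ψ.left_inv hψ] using hCU hzC⟩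
  obtain ⟨ρ, hρ, hball⟩ := Metric.isOpen_iff.1 hO _ hzO
  have han : AnalyticOnNhd ℂ (F ∘ ψ.symm) (Metric.ball (ψ z) ρ) := by
    intro y hy
    refine ContDiffAt.analyticAt (contMDiffAt_iff_contDiffAt.1 ?_)
    exact (hF.contMDiffAt (hU.mem_nhds (hball hy).2)).comp y
      (contMDiffOn_chart_symm.contMDiffAt (ψ.open_target.mem_nhds (hball hy).1))
  have hN : ψ.source ∩ ψ ⁻¹' Metric.ball (ψ z) ρ ∈ 𝓝 z :=
    (ψ.isOpen_inter_preimage Metric.isOpen_ball).mem_nhds ⟨hψ, Metric.mem_ball_self hρ⟩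
  obtain ⟨w, ⟨hws, hwb⟩, hw0⟩ := mem_closure_iff_nhds.1 hzc _ hN
  have hw1 : F ∘ ψ.symm =ᶠ[𝓝 (ψ w)] 0 := by
    have hc := ψ.continuousAt_symm (ψ.map_source hws)
    rw [ContinuousAt, ψ.left_inv hws] at hc
    exact hc.eventually hw0
  have hzero := han.eqOn_zero_of_preconnected_of_eventuallyEq_zero
    (convex_ball (ψ z) ρ).isPreconnected hwb hw1
  filter_upwards [hN] with y hy
  simpa [ψ.left_inv hy.1] using hzero hy.2

end IdentityTheorem

/-! ### Uniqueness of holomorphic extension from a subgroup spanning the Lie algebra over ℂ -/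

section TotallyReal

universe u

variable {n : ℕ}
  {G : Type*} [TopologicalSpace G] [ChartedSpace (EuclideanSpace ℝ (Fin n)) G] [Group G]
  [LieGroup (𝓡 n) ω G]
  {GC : Type*} [TopologicalSpace GC] [ChartedSpace (EuclideanSpace ℂ (Fin n)) GC] [Group GC]
  [LieGroup 𝓘(ℂ, EuclideanSpace ℂ (Fin n)) ω GC]

local notation "E" => EuclideanSpace ℂ (Fin n)

/-- Vanishing along φ kills the derivatives of F in the directions of the image of dφ. These span
over ℂ and the differential is complex linear, so the whole differential vanishes along φ too.
Induction applies this to the differential itself; the value space H therefore has to vary, from H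
to E →L[ℂ] H. -/
theorem IsLieSubgroup.iteratedFDeriv_eq_zero {φ : G →* GC} (hφ : IsLieSubgroup (n := n) φ)
    (hspan : Submodule.span ℂ (Set.range (lieDifferential (n := n) φ)) = ⊤) {g : G} (k : ℕ) :
    ∀ {H : Type u} [NormedAddCommGroup H] [NormedSpace ℂ H] {F : GC → H},
      ContMDiffAt 𝓘(ℂ, E) 𝓘(ℂ, H) ω F (φ g) → F ∘ φ =ᶠ[𝓝 g] 0 →
        iteratedFDeriv ℂ k (F ∘ (chartAt E (φ g)).symm) (chartAt E (φ g) (φ g)) = 0 := by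
  set ψ := chartAt E (φ g) with hψ
  have hs : φ g ∈ ψ.source := mem_chart_source E (φ g)
  have ht : ψ (φ g) ∈ ψ.target := ψ.map_source hs
  induction k with
  | zero =>
    intro H _ _ F hF h0
    ext m
    simpa [ψ.left_inv hs] using h0.eq_of_nhds
  | succ k ih =>
    intro H _ _ F hF h0
    have hF' : ContMDiffAt 𝓘(ℂ, E) 𝓘(ℂ, H) ω F (ψ.symm (ψ (φ g))) := by
      rwa [ψ.left_inv hs]
    have hsm := (contDiffAt_comp_chart_symm ht hF').fderiv_right (m := ω) (by simp)
    have hev : (fderiv ℂ (F ∘ ψ.symm) ∘ ψ) ∘ ψ.symm =ᶠ[𝓝 (ψ (φ g))]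
        fderiv ℂ (F ∘ ψ.symm) := by
      filter_upwards [ψ.open_target.mem_nhds ht] with y hy
      simp [ψ.right_inv hy]
    have h1 : ContMDiffAt 𝓘(ℂ, E) 𝓘(ℂ, E →L[ℂ] H) ω (fderiv ℂ (F ∘ ψ.symm) ∘ ψ) (φ g) :=
      contMDiffAt_of_comp_chart_symm hs (hsm.congr_of_eventuallyEq hev)
    have h2 : (fderiv ℂ (F ∘ ψ.symm) ∘ ψ) ∘ φ =ᶠ[𝓝 g] 0 := by
      have hc := hφ.contMDiff.continuous.continuousAt (x := g)
      filter_upwards [h0.eventuallyEq_nhds, hc.eventually (ψ.open_source.mem_nhds hs),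
        hc.eventually ((contMDiffAt_iff_contMDiffAt_nhds (by simp)).1 hF)] with y hy0 hys hyF
      have hyt : ψ (φ y) ∈ ψ.target := ψ.map_source hys
      have hyF' : ContMDiffAt 𝓘(ℂ, E) 𝓘(ℂ, H) ω F (ψ.symm (ψ (φ y))) := by
        rwa [ψ.left_inv hys]
      let D : E →L[ℂ] H := (fderiv ℂ (F ∘ ψ.symm) (ψ (φ y))).comp (chartFrame ℂ ψ (ψ (φ y)))
      have hD : ∀ v : GroupLieAlgebra 𝓘(ℂ, E) GC, D v = 0 := by
        intro v
        have hv : v ∈ Submodule.span ℂ (Set.range (lieDifferential (n := n) φ)) := by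
          rw [hspan]; trivial
        induction hv using Submodule.span_induction with
        | mem x hx =>
          obtain ⟨u, rfl⟩ := hx
          have e1 := invDeriv_chart_symm hyt hyF' (lieDifferential (n := n) φ u)
          rw [ψ.left_inv hys, ← hφ.invDeriv_comp hyF, invDeriv_congr hy0] at e1
          refine e1.symm.trans ?_
          refine (DFunLike.congr_fun (mfderiv_const (c := (0 : H))) u).trans ?_
          rfl
        | zero => exact map_zero D
        | add x y _ _ hx hy => exact (map_add D x y).trans ((congrArg₂ (· + ·) hx hy).trans (add_zero 0))
        | smul a x _ hx => exact (map_smul D a x).trans ((congrArg (a • ·) hx).trans (smul_zero a))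
      -- Every direction w in the chart is a frame vector, so `hD` reaches all of them.
      ext w
      have h4 := hD (chartCoframe ℂ ψ (ψ (φ y)) w)
      rwa [ContinuousLinearMap.comp_apply, chartFrame_rightInverse hyt] at h4
    have h3 := ih h1 h2
    rw [(hev.iteratedFDeriv ℂ k).eq_of_nhds] at h3
    rw [← norm_eq_zero, ← norm_iteratedFDeriv_fderiv, h3, norm_zero]

theorem IsLieSubgroup.eqOn_zero {φ : G →* GC} (hφ : IsLieSubgroup (n := n) φ)
    (hspan : Submodule.span ℂ (Set.range (lieDifferential (n := n) φ)) = ⊤)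
    {W : Set G} (hW : IsOpen W) {WC : Set GC} (hWC : IsOpen WC) (hsub : W ⊆ φ ⁻¹' WC)
    (hmeet : ∀ z ∈ WC, (connectedComponentIn WC z ∩ φ '' W).Nonempty)
    {F : GC → ℂ} (hF : ContMDiffOn 𝓘(ℂ, E) 𝓘(ℂ) ω F WC) (h0 : ∀ x ∈ W, F (φ x) = 0) :
    ∀ z ∈ WC, F z = 0 := by
  intro z hz
  obtain ⟨_, hC, g, hg, rfl⟩ := hmeet z hz
  have hFg : ContMDiffAt 𝓘(ℂ, E) 𝓘(ℂ) ω F (φ g) := hF.contMDiffAt (hWC.mem_nhds (hsub hg))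
  have hs : φ g ∈ (chartAt E (φ g)).source := mem_chart_source E (φ g)
  have h1 : F =ᶠ[𝓝 (φ g)] 0 := by
    have hFg' : ContMDiffAt 𝓘(ℂ, E) 𝓘(ℂ) ω F ((chartAt E (φ g)).symm (chartAt E (φ g) (φ g))) := by
      rwa [(chartAt E (φ g)).left_inv hs]
    have han := ContDiffAt.analyticAt
      (contDiffAt_comp_chart_symm (mem_chart_target E (φ g)) hFg')
    have hz := han.eventually_eq_zero_of_iteratedFDeriv fun k =>
      hφ.iteratedFDeriv_eq_zero hspan k hFg
        (by filter_upwards [hW.mem_nhds hg] with y hy using h0 y hy)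
    have hc := ((chartAt E (φ g)).continuousAt hs).eventually hz
    filter_upwards [hc, (chartAt E (φ g)).open_source.mem_nhds hs] with y hy hys
    simpa [(chartAt E (φ g)).left_inv hys] using hy
  exact (isPreconnected_connectedComponentIn.eventuallyEq_zero_of_holomorphic hWC
    (connectedComponentIn_subset WC z) hF hC h1 z (mem_connectedComponentIn hz)).eq_of_nhds

end TotallyReal

open Matrix

/-! ### Jacobi's formula for the derivative of a determinant -/

section DetDerivative

theorem _root_.HasFDerivAt.matrix_det {V m : Type*} [NormedAddCommGroup V] [NormedSpace ℝ V]
    [Fintype m] [DecidableEq m] {A : V → Matrix m m ℝ} {A' : m → m → V →L[ℝ] ℝ} {z : V}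
    (h : ∀ i j, HasFDerivAt (fun y => A y i j) (A' i j) z) :
    HasFDerivAt (fun y => (A y).det) (∑ i, ∑ j, (A z).adjugate j i • A' i j) z := by
  have h1 : HasFDerivAt (fun y => (A y).det)
      (∑ σ : Equiv.Perm m, ((Equiv.Perm.sign σ : ℤ) : ℝ) •
        ∑ i, (∏ l ∈ Finset.univ.erase i, A z (σ l) l) • A' (σ i) i) z := by
    simp only [Matrix.det_apply']
    exact HasFDerivAt.fun_sum fun σ _ =>
      (HasFDerivAt.finsetProd (u := Finset.univ) fun i _ => h (σ i) i).const_mul _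
  convert h1 using 1
  ext v
  simp only [_root_.sum_apply, _root_.smul_apply, smul_eq_mul]
  have h2 : ∀ j, ∑ i, (A z).adjugate j i * A' i j v =
      ∑ σ : Equiv.Perm m, ((Equiv.Perm.sign σ : ℤ) : ℝ) *
        ((∏ l ∈ Finset.univ.erase j, A z (σ l) l) * A' (σ j) j v) := by
    intro j
    -- Cramer's rule: the adjugate sum is the determinant with column j replaced by its derivative.
    have h3 : ∑ i, (A z).adjugate j i * A' i j v =
        ((A z).updateCol j fun i => A' i j v).det := by
      rw [← Matrix.cramer_apply, Matrix.cramer_eq_adjugate_mulVec]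
      rfl
    rw [h3, Matrix.det_apply']
    refine Finset.sum_congr rfl fun σ _ => ?_
    rw [← Finset.mul_prod_erase _ _ (Finset.mem_univ j), Matrix.updateCol_self, mul_comm (A' _ _ _)]
    congr 2
    refine Finset.prod_congr rfl fun l hl => ?_
    rw [Matrix.updateCol_ne (Finset.ne_of_mem_erase hl)]
  rw [Finset.sum_comm]
  simp only [h2]
  rw [Finset.sum_comm]
  simp only [Finset.mul_sum]

end DetDerivative

/-! ### The Laplacian in a divergence-free frame -/

section Frame

variable {n : ℕ}

local notation "V" => EuclideanSpace ℝ (Fin n)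

/-- The columns of A are frame fields with structure constants C, and |det A|⁻¹ is the density of
the volume they normalise. The divergence of the b-th field is, up to sign, the trace of ad of that
field, and `htr` makes it zero. -/
theorem sum_fderiv_inv_det_mul_eq_zero {A : V → Matrix (Fin n) (Fin n) ℝ} {y : V}
    (hA : ∀ i j, DifferentiableAt ℝ (fun z => A z i j) y) (hdet : (A y).det ≠ 0)
    (C : Fin n → Fin n → Fin n → ℝ)
    (hC : ∀ b c i, ∑ j, (A y j b * fderiv ℝ (fun z => A z i c) y (.single j 1) -
      A y j c * fderiv ℝ (fun z => A z i b) y (.single j 1)) = ∑ d, C b c d * A y i d)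
    (htr : ∀ b, ∑ c, C b c c = 0) (b : Fin n) :
    ∑ j, fderiv ℝ (fun z => (A z).det⁻¹ * A z j b) y (.single j 1) = 0 := by
  set δ := (A y).det with hδ
  have hd := HasFDerivAt.matrix_det fun i j => (hA i j).hasFDerivAt
  -- Multiplying by δ² clears the denominators left by Jacobi's formula and the derivative of the
  -- inverse.
  have h1 : ∀ j, δ ^ 2 * fderiv ℝ (fun z => (A z).det⁻¹ * A z j b) y (.single j 1) =
      δ * fderiv ℝ (fun z => A z j b) y (.single j 1) -
        ∑ i, ∑ c, (A y).adjugate c i * (A y j b * fderiv ℝ (fun z => A z i c) y (.single j 1)) := by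
    intro j
    have h2 := (((hasDerivAt_inv hdet).comp_hasFDerivAt y hd).mul (hA j b).hasFDerivAt).fderiv
    have h3 : (fun z => (A z).det⁻¹ * A z j b) = (Inv.inv ∘ fun z => (A z).det) * fun z => A z j b := rfl
    rw [h3, h2]
    simp only [_root_.add_apply, _root_.smul_apply, _root_.sum_apply, smul_eq_mul,
      Function.comp_apply, ← hδ]
    have h4 : ∑ i, ∑ c, (A y).adjugate c i * (A y j b * fderiv ℝ (fun z => A z i c) y (.single j 1)) =
        A y j b * ∑ i, ∑ c, (A y).adjugate c i * fderiv ℝ (fun z => A z i c) y (.single j 1) := by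
      simp only [Finset.mul_sum]
      exact Finset.sum_congr rfl fun i _ => Finset.sum_congr rfl fun c _ => by ring
    rw [h4]
    field_simp
    ring
  have h5 : ∀ i j, ∑ c, A y j c * (A y).adjugate c i = if j = i then δ else 0 := by
    intro i j
    have := congrFun (congrFun (Matrix.mul_adjugate (A y)) j) i
    simpa [Matrix.mul_apply, Matrix.one_apply] using this
  have h6 : ∀ c i, ∑ a, (A y).adjugate c a * A y a i = if c = i then δ else 0 := by
    intro c i
    have := congrFun (congrFun (Matrix.adjugate_mul (A y)) c) i
    simpa [Matrix.mul_apply, Matrix.one_apply] using this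
  -- Contracting the bracket relation with the adjugate turns its right side into δ ∑ C b c c = 0.
  -- The left side is the negative of δ² times the divergence sought.
  have h7 : ∑ i, ∑ c, (A y).adjugate c i *
      ∑ j, (A y j b * fderiv ℝ (fun z => A z i c) y (.single j 1) -
        A y j c * fderiv ℝ (fun z => A z i b) y (.single j 1)) = 0 := by
    simp only [hC, Finset.mul_sum]
    rw [Finset.sum_comm]
    calc ∑ c, ∑ i, ∑ d, (A y).adjugate c i * (C b c d * A y i d)
        = ∑ c, ∑ d, C b c d * ∑ i, (A y).adjugate c i * A y i d := by
          refine Finset.sum_congr rfl fun c _ => ?_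
          rw [Finset.sum_comm]
          refine Finset.sum_congr rfl fun d _ => ?_
          rw [Finset.mul_sum]
          exact Finset.sum_congr rfl fun i _ => by ring
      _ = 0 := by simp [h6, ← Finset.sum_mul, htr]
  have h8 : δ ^ 2 * ∑ j, fderiv ℝ (fun z => (A z).det⁻¹ * A z j b) y (.single j 1) = 0 := by
    rw [Finset.mul_sum, Finset.sum_congr rfl fun j _ => h1 j, Finset.sum_sub_distrib]
    have h9 : ∑ j, ∑ i, ∑ c, (A y).adjugate c i *
          (A y j b * fderiv ℝ (fun z => A z i c) y (.single j 1)) -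
        ∑ j, δ * fderiv ℝ (fun z => A z j b) y (.single j 1) = 0 := by
      rw [← h7]
      simp only [Finset.sum_sub_distrib, mul_sub]
      congr 1
      · rw [Finset.sum_comm]
        refine Finset.sum_congr rfl fun i _ => ?_
        rw [Finset.sum_comm]
        simp only [Finset.mul_sum]
      · have h10 : ∀ i, ∑ c, (A y).adjugate c i * ∑ j, A y j c *
            fderiv ℝ (fun z => A z i b) y (.single j 1) = δ * fderiv ℝ (fun z => A z i b) y (.single i 1) := by
          intro i
          simp only [Finset.mul_sum]
          rw [Finset.sum_comm]
          calc ∑ j, ∑ c, (A y).adjugate c i * (A y j c * fderiv ℝ (fun z => A z i b) y (.single j 1))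
              = ∑ j, (∑ c, A y j c * (A y).adjugate c i) *
                  fderiv ℝ (fun z => A z i b) y (.single j 1) := by
                refine Finset.sum_congr rfl fun j _ => ?_
                rw [Finset.sum_mul]
                exact Finset.sum_congr rfl fun c _ => by ring
            _ = _ := by simp [h5]
        exact (Finset.sum_congr rfl fun i _ => h10 i).symm
    linarith
  exact (mul_eq_zero.1 h8).resolve_left (pow_ne_zero 2 hdet)

/-- The Laplacian is the divergence of the gradient ∑ Q_ab (X_a f) X_b. As each X_b is divergence
free, the product rule leaves only ∑ Q_ab X_b X_a f. -/
theorem laplacian_eq_sum_frame {A G : V → Matrix (Fin n) (Fin n) ℝ} {y : V}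
    (hA : ∀ i j, DifferentiableAt ℝ (fun z => A z i j) y) (hdet : (A y).det ≠ 0)
    (hdiv : ∀ b, ∑ j, fderiv ℝ (fun z => (A z).det⁻¹ * A z j b) y (.single j 1) = 0)
    (Q : Matrix (Fin n) (Fin n) ℝ) {s : ℝ} (hs : s ≠ 0)
    (hG : ∀ᶠ z in 𝓝 y, (G z)⁻¹ = A z * Q * (A z)ᵀ)
    (hG' : ∀ᶠ z in 𝓝 y, Real.sqrt |(G z).det| = s * |(A z).det|⁻¹)
    {f : V → ℂ} (hf : ∀ i, DifferentiableAt ℝ (fun z => fderiv ℝ f z (.single i 1)) y)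
    {u : Fin n → V → ℂ}
    (hu : ∀ a, u a =ᶠ[𝓝 y] fun z => ∑ i, A z i a • fderiv ℝ f z (.single i 1)) :
    (Real.sqrt |(G y).det|)⁻¹ • ∑ i, ∑ j, fderiv ℝ
        (fun z => ((G z)⁻¹ i j * Real.sqrt |(G z).det|) • fderiv ℝ f z (.single i 1)) y (.single j 1) =
      ∑ a, ∑ b, Q a b • ∑ j, A y j b • fderiv ℝ (u a) y (.single j 1) := by
  have hdetd : DifferentiableAt ℝ (fun z => (A z).det) y :=
    (HasFDerivAt.matrix_det fun i j => (hA i j).hasFDerivAt).differentiableAt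
  have hinv : DifferentiableAt ℝ (fun z => (A z).det⁻¹) y := hdetd.fun_inv hdet
  -- σ is the sign of det A, locally constant; it trades the absolute value for a differentiable
  -- expression.
  obtain ⟨σ, hσ0, hσ⟩ : ∃ σ : ℝ, σ ≠ 0 ∧ ∀ᶠ z in 𝓝 y, |(A z).det|⁻¹ = σ * (A z).det⁻¹ := by
    rcases lt_or_gt_of_ne hdet with h | h
    · refine ⟨-1, by norm_num, ?_⟩
      filter_upwards [hdetd.continuousAt.eventually_lt continuousAt_const h] with z hz
      rw [abs_of_neg hz, inv_neg]; ring
    · refine ⟨1, one_ne_zero, ?_⟩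
      filter_upwards [continuousAt_const.eventually_lt hdetd.continuousAt h] with z hz
      rw [abs_of_pos hz, one_mul]
  have hud : ∀ a, DifferentiableAt ℝ (u a) y := fun a =>
    ((DifferentiableAt.fun_sum fun i _ => (hA i a).smul (hf i)).congr_of_eventuallyEq (hu a))
  have hcoef : ∀ i j, (fun z => ((G z)⁻¹ i j * Real.sqrt |(G z).det|) • fderiv ℝ f z (.single i 1)) =ᶠ[𝓝 y]
      fun z => (s * σ) • ∑ a, ∑ b, Q a b • ((A z).det⁻¹ * A z j b) • A z i a •
        fderiv ℝ f z (.single i 1) := by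
    intro i j
    filter_upwards [hG, hG', hσ] with z h1 h2 h3
    rw [h1, h2, h3]
    simp only [Matrix.mul_apply, Matrix.transpose_apply, Finset.smul_sum, smul_smul,
      Finset.sum_mul, Finset.sum_smul]
    rw [Finset.sum_comm]
    exact Finset.sum_congr rfl fun a _ => Finset.sum_congr rfl fun b _ => by congr 1; ring
  have hterm : ∀ i j a b, DifferentiableAt ℝ (fun z => ((A z).det⁻¹ * A z j b) • A z i a •
      fderiv ℝ f z (.single i 1)) y := fun i j a b =>
    (hinv.mul (hA j b)).smul ((hA i a).smul (hf i))
  have h1 : ∀ j, ∑ i, fderiv ℝ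
        (fun z => ((G z)⁻¹ i j * Real.sqrt |(G z).det|) • fderiv ℝ f z (.single i 1)) y (.single j 1) =
      (s * σ) • ∑ a, ∑ b, Q a b • ((fderiv ℝ (fun z => (A z).det⁻¹ * A z j b) y (.single j 1)) • u a y +
        ((A y).det⁻¹ * A y j b) • fderiv ℝ (u a) y (.single j 1)) := by
    intro j
    have h2 : ∀ a b, fderiv ℝ (fun z => ((A z).det⁻¹ * A z j b) • u a z) y (.single j 1) =
        (fderiv ℝ (fun z => (A z).det⁻¹ * A z j b) y (.single j 1)) • u a y +
        ((A y).det⁻¹ * A y j b) • fderiv ℝ (u a) y (.single j 1) := by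
      intro a b
      rw [fderiv_fun_smul (hinv.fun_mul (hA j b)) (hud a)]
      simp [add_comm]
    have h3 : ∀ a b, fderiv ℝ (fun z => ((A z).det⁻¹ * A z j b) • u a z) y =
        ∑ i, fderiv ℝ (fun z => ((A z).det⁻¹ * A z j b) • A z i a • fderiv ℝ f z (.single i 1)) y := by
      intro a b
      rw [← fderiv_fun_sum fun i _ => hterm i j a b]
      refine Filter.EventuallyEq.fderiv_eq ?_
      filter_upwards [hu a] with z hz
      rw [hz, Finset.smul_sum]
    have h4 : ∀ i, fderiv ℝ
        (fun z => ((G z)⁻¹ i j * Real.sqrt |(G z).det|) • fderiv ℝ f z (.single i 1)) y =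
        (s * σ) • ∑ a, ∑ b, Q a b • fderiv ℝ (fun z => ((A z).det⁻¹ * A z j b) • A z i a •
          fderiv ℝ f z (.single i 1)) y := by
      intro i
      rw [(hcoef i j).fderiv_eq, fderiv_fun_const_smul, fderiv_fun_sum]
      · congr 1
        refine Finset.sum_congr rfl fun a _ => ?_
        rw [fderiv_fun_sum fun b _ => (hterm i j a b).fun_const_smul _]
        exact Finset.sum_congr rfl fun b _ => fderiv_fun_const_smul (hterm i j a b) _
      · exact fun a _ => DifferentiableAt.fun_sum fun b _ => (hterm i j a b).fun_const_smul _
      · exact DifferentiableAt.fun_sum fun a _ =>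
          DifferentiableAt.fun_sum fun b _ => (hterm i j a b).fun_const_smul _
    simp only [← h2, h3, h4]
    simp only [_root_.smul_apply, _root_.sum_apply, ← Finset.smul_sum]
    congr 1
    rw [Finset.sum_comm]
    refine Finset.sum_congr rfl fun a _ => ?_
    rw [Finset.sum_comm]
    simp only [Finset.smul_sum]
  rw [Finset.sum_comm]
  simp only [h1]
  rw [hG'.self_of_nhds, hσ.self_of_nhds, ← Finset.smul_sum, Finset.sum_comm, smul_smul,
    Finset.smul_sum]
  refine Finset.sum_congr rfl fun a _ => ?_
  rw [Finset.sum_comm, Finset.smul_sum]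
  refine Finset.sum_congr rfl fun b _ => ?_
  simp only [← Finset.smul_sum, smul_add, Finset.sum_add_distrib, ← Finset.sum_smul, hdiv b]
  simp only [zero_smul, smul_zero, zero_add, Finset.smul_sum, smul_smul]
  refine Finset.sum_congr rfl fun j _ => ?_
  congr 1
  field_simp

end Frame

/-! ### The standard basis of the Lie algebra -/

section StandardBasis

variable {𝕜 : Type*} [RCLike 𝕜] {n : ℕ}

variable (𝕜) in
/-- The standard basis of the model space, as a basis of the Lie algebra. -/
noncomputable def lieBasis (n : ℕ) (G : Type*) [TopologicalSpace G]
    [ChartedSpace (EuclideanSpace 𝕜 (Fin n)) G] [Group G] :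
    Module.Basis (Fin n) 𝕜 (GroupLieAlgebra 𝓘(𝕜, EuclideanSpace 𝕜 (Fin n)) G) :=
  (EuclideanSpace.basisFun (Fin n) 𝕜).toBasis

theorem lieBasis_apply {G : Type*} [TopologicalSpace G]
    [ChartedSpace (EuclideanSpace 𝕜 (Fin n)) G] [Group G] (a : Fin n) :
    lieBasis 𝕜 n G a = (EuclideanSpace.single a 1 : EuclideanSpace 𝕜 (Fin n)) :=
  EuclideanSpace.basisFun_apply (Fin n) 𝕜 a

end StandardBasis

/-! ### The Laplace-Beltrami operator of a left-invariant metric -/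

section Tension

variable {n : ℕ}

local notation "V" => EuclideanSpace ℝ (Fin n)

theorem _root_.EuclideanSpace.sum_smul_single {𝕜 : Type*} [RCLike 𝕜] {m : Type*} [Fintype m] [DecidableEq m]
    (x : EuclideanSpace 𝕜 m) : ∑ i, x i • EuclideanSpace.single i (1 : 𝕜) = x := by
  simpa using (EuclideanSpace.basisFun m 𝕜).sum_repr x

theorem _root_.LinearMap.map_eq_sum_single {𝕜 : Type*} [RCLike 𝕜] {m H : Type*} [Fintype m]
    [DecidableEq m] [AddCommGroup H] [Module 𝕜 H] (L : EuclideanSpace 𝕜 m →ₗ[𝕜] H)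
    (x : EuclideanSpace 𝕜 m) : L x = ∑ i, x i • L (EuclideanSpace.single i 1) := by
  conv_lhs => rw [← EuclideanSpace.sum_smul_single x]
  simp

variable {G : Type*} [TopologicalSpace G] [ChartedSpace (EuclideanSpace ℝ (Fin n)) G] [Group G]

theorem bilinForm_eq_sum_toMatrix (B : LinearMap.BilinForm ℝ (GroupLieAlgebra (𝓡 n) G))
    (v w : V) : B v w = ∑ a, ∑ b, v a * LinearMap.BilinForm.toMatrix (lieBasis ℝ n G) B a b * w b := by
  have h1 := LinearMap.map_eq_sum_single (𝕜 := ℝ) (show V →ₗ[ℝ] V →ₗ[ℝ] ℝ from B) v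
  have h2 := congrArg (fun L : V →ₗ[ℝ] ℝ => L w) h1
  refine h2.trans ?_
  simp only [LinearMap.sum_apply, LinearMap.smul_apply, smul_eq_mul]
  refine Finset.sum_congr rfl fun a _ => ?_
  rw [LinearMap.map_eq_sum_single (𝕜 := ℝ) _ w, Finset.mul_sum]
  refine Finset.sum_congr rfl fun b _ => ?_
  rw [smul_eq_mul]
  simp only [LinearMap.BilinForm.toMatrix_apply, lieBasis_apply]
  change _ * (_ * B _ _) = _ * B _ _ * _
  ring

variable [LieGroup (𝓡 n) ω G]

/-- The left-invariant frame fits `laplacian_eq_sum_frame`: B has constant coefficients in it, and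
`htr` (unimodularity) makes its fields divergence free. -/
theorem tension_leftInvariantMetric (B : LinearMap.BilinForm ℝ (GroupLieAlgebra (𝓡 n) G))
    (hB : (LinearMap.BilinForm.toMatrix (lieBasis ℝ n G) B).det ≠ 0)
    (htr : ∀ v : GroupLieAlgebra (𝓡 n) G,
      ∑ c, (lieBasis ℝ n G).repr ⁅v, lieBasis ℝ n G c⁆ c = 0)
    {f : G → ℂ} {x : G} (hf : ContMDiffAt (𝓡 n) 𝓘(ℝ, ℂ) ω f x) :
    tension (leftInvariantMetric B) f x =
      ∑ a, ∑ b, (LinearMap.BilinForm.toMatrix (lieBasis ℝ n G) B)⁻¹ a b •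
        invDeriv (lieBasis ℝ n G b)
          (invDeriv (lieBasis ℝ n G a) f) x := by
  set ψ := chartAt V x with hψ
  set y := ψ x with hy
  have hyt : y ∈ ψ.target := mem_chart_target V x
  have hx : ψ.symm y = x := ψ.left_inv (mem_chart_source V x)
  have hf' : ContMDiffAt (𝓡 n) 𝓘(ℝ, ℂ) ω f (ψ.symm y) := by rwa [hx]
  -- The columns of A are the left-invariant fields in the chart and the rows of N the dual forms,
  -- so the metric matrix is NᵀBN with B constant.
  let A : V → Matrix (Fin n) (Fin n) ℝ := fun z =>
    Matrix.of fun i a => chartFrame ℝ ψ z (lieBasis ℝ n G a) i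
  let N : V → Matrix (Fin n) (Fin n) ℝ := fun z =>
    Matrix.of fun a i => chartCoframe ℝ ψ z (EuclideanSpace.single i 1) a
  have hNA : ∀ z ∈ ψ.target, N z * A z = 1 := by
    intro z hz
    ext a b
    have h1 := chartFrame_leftInverse (𝕜 := ℝ) hz (lieBasis ℝ n G b)
    have h2 := LinearMap.map_eq_sum_single (chartCoframe ℝ ψ z).toLinearMap
      (chartFrame ℝ ψ z (lieBasis ℝ n G b))
    have h3 := congrArg (fun w : V => w a) (h2.symm.trans h1)
    simp only [Matrix.mul_apply, A, N, Matrix.of_apply, Matrix.one_apply]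
    simp only [smul_eq_mul, WithLp.ofLp_sum, Finset.sum_apply, WithLp.ofLp_smul,
      Pi.smul_apply] at h3
    rw [lieBasis_apply] at h3
    simpa [lieBasis_apply, mul_comm, Pi.single_apply] using h3
  have hmet : ∀ z, metricMatrix (leftInvariantMetric B) ψ z = (N z)ᵀ * LinearMap.BilinForm.toMatrix (lieBasis ℝ n G) B * N z := by
    intro z
    ext i j
    have h1 := bilinForm_eq_sum_toMatrix B (chartCoframe ℝ ψ z (EuclideanSpace.single i 1))
      (chartCoframe ℝ ψ z (EuclideanSpace.single j 1))
    refine Eq.trans ?_ (h1.trans ?_)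
    · rfl
    · simp only [Matrix.mul_apply, Matrix.transpose_apply, Finset.sum_mul]
      rw [Finset.sum_comm]
      rfl
  have hdet : ∀ z ∈ ψ.target, (N z).det * (A z).det = 1 := fun z hz => by
    rw [← Matrix.det_mul, hNA z hz, Matrix.det_one]
  have hdet0 : ∀ z ∈ ψ.target, (A z).det ≠ 0 := fun z hz h => by
    simpa [h] using hdet z hz
  have hFd : ∀ a, DifferentiableAt ℝ (fun z => chartFrame ℝ ψ z (lieBasis ℝ n G a)) y :=
    fun a => ((contDiffAt_chartFrame hyt).clm_apply contDiffAt_const).differentiableAt (by simp)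
  have hAd : ∀ i a, HasFDerivAt (fun z => A z i a) ((EuclideanSpace.proj i).comp
      (fderiv ℝ (fun z => chartFrame ℝ ψ z (lieBasis ℝ n G a)) y)) y := fun i a =>
    (EuclideanSpace.proj (𝕜 := ℝ) i).hasFDerivAt.comp y (hFd a).hasFDerivAt
  have hAexp : ∀ {H : Type} [AddCommGroup H] [Module ℝ H] (L : V →ₗ[ℝ] H) (z : V) (a : Fin n),
      L (chartFrame ℝ ψ z (lieBasis ℝ n G a)) =
        ∑ j, A z j a • L (EuclideanSpace.single j 1) := fun L z a =>
    LinearMap.map_eq_sum_single L _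
  have hdiv : ∀ b, ∑ j, fderiv ℝ (fun z => (A z).det⁻¹ * A z j b) y (.single j 1) = 0 := by
    refine sum_fderiv_inv_det_mul_eq_zero (fun i a => (hAd i a).differentiableAt) (hdet0 y hyt)
      (fun b c d => (lieBasis ℝ n G).repr (⁅(lieBasis ℝ n G b), (lieBasis ℝ n G c)⁆ :
        GroupLieAlgebra (𝓡 n) G) d) ?_ fun b => htr _
    intro b c i
    have h1 := chart_lieBracket (𝕜 := ℝ) hyt (lieBasis ℝ n G b)
      (lieBasis ℝ n G c)
    have h2 := congrArg (fun w : V => w i) h1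
    simp only [VectorField.lieBracket] at h2
    have h3 := LinearMap.map_eq_sum_single (𝕜 := ℝ) (chartFrame ℝ ψ y).toLinearMap
      (⁅(lieBasis ℝ n G b), (lieBasis ℝ n G c)⁆ :
        GroupLieAlgebra (𝓡 n) G)
    have h4 := congrArg (fun w : V => w i) h3
    have h5 := h2.trans h4
    have h6 := hAexp ((EuclideanSpace.proj (𝕜 := ℝ) i).comp
      (fderiv ℝ (fun z => chartFrame ℝ ψ z (lieBasis ℝ n G c)) y)).toLinearMap y b
    have h7 := hAexp ((EuclideanSpace.proj (𝕜 := ℝ) i).comp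
      (fderiv ℝ (fun z => chartFrame ℝ ψ z (lieBasis ℝ n G b)) y)).toLinearMap y c
    rw [Finset.sum_sub_distrib]
    simp only [(hAd _ _).fderiv]
    refine (congrArg₂ (· - ·) h6 h7).symm.trans (h5.trans ?_)
    simp [A, lieBasis_apply]
    rfl
  have hu : ∀ a, (invDeriv (lieBasis ℝ n G a) f) ∘ ψ.symm =ᶠ[𝓝 y]
      fun z => ∑ i, A z i a • fderiv ℝ (f ∘ ψ.symm) z (.single i 1) := by
    intro a
    filter_upwards [invDeriv_comp_chart_symm hyt hf' (lieBasis ℝ n G a)] with z hz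
    exact hz.trans (hAexp (fderiv ℝ (f ∘ ψ.symm) z).toLinearMap z a)
  have hfd : ∀ i : Fin n, DifferentiableAt ℝ
      (fun z => fderiv ℝ (f ∘ ψ.symm) z (.single i 1)) y := fun i =>
    (((contDiffAt_comp_chart_symm hyt hf').fderiv_right (m := ω) (by simp)).clm_apply
      contDiffAt_const).differentiableAt (by simp)
  have hG : ∀ᶠ z in 𝓝 y, (metricMatrix (leftInvariantMetric B) ψ z)⁻¹ =
      A z * (LinearMap.BilinForm.toMatrix (lieBasis ℝ n G) B)⁻¹ * (A z)ᵀ := by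
    filter_upwards [ψ.open_target.mem_nhds hyt] with z hz
    have h1 : (N z)⁻¹ = A z := Matrix.inv_eq_right_inv (hNA z hz)
    rw [hmet, Matrix.mul_inv_rev, Matrix.mul_inv_rev, ← Matrix.transpose_nonsing_inv, h1,
      Matrix.mul_assoc]
  have hG' : ∀ᶠ z in 𝓝 y, Real.sqrt |(metricMatrix (leftInvariantMetric B) ψ z).det| =
      Real.sqrt |(LinearMap.BilinForm.toMatrix (lieBasis ℝ n G) B).det| * |(A z).det|⁻¹ := by
    filter_upwards [ψ.open_target.mem_nhds hyt] with z hz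
    have h1 : |(A z).det|⁻¹ = |(N z).det| := by
      refine inv_eq_of_mul_eq_one_left ?_
      rw [← abs_mul, hdet z hz, abs_one]
    have h2 : |(metricMatrix (leftInvariantMetric B) ψ z).det| =
        |(LinearMap.BilinForm.toMatrix (lieBasis ℝ n G) B).det| * |(N z).det| ^ 2 := by
      rw [hmet, Matrix.det_mul, Matrix.det_mul, Matrix.det_transpose, abs_mul, abs_mul]
      ring
    rw [h1, h2, Real.sqrt_mul (abs_nonneg _), Real.sqrt_sq (abs_nonneg _)]
  have h0 := laplacian_eq_sum_frame (fun i a => (hAd i a).differentiableAt) (hdet0 y hyt) hdiv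
    (LinearMap.BilinForm.toMatrix (lieBasis ℝ n G) B)⁻¹ (Real.sqrt_ne_zero'.2 (abs_pos.2 hB)) hG hG' hfd hu
  refine Eq.trans h0 ?_
  refine Finset.sum_congr rfl fun a _ => Finset.sum_congr rfl fun b _ => ?_
  congr 1
  have h1 := invDeriv_chart_symm hyt (contMDiffAt_invDeriv hf' (lieBasis ℝ n G a))
    (lieBasis ℝ n G b)
  rw [hx] at h1
  exact ((hAexp (fderiv ℝ ((invDeriv (lieBasis ℝ n G a) f) ∘ ψ.symm)
    y).toLinearMap y b).symm.trans h1.symm)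

end Tension

/-! ### Killing forms: unimodularity, contraction, complexification -/

section KillingForm

/-- By invariance, ad x is skew for the Killing form, so it is conjugate to minus its transpose and
its trace equals its own negative. -/
theorem trace_ad_eq_zero {K L : Type*} [Field K] [CharZero K] [LieRing L] [LieAlgebra K L]
    [Module.Finite K L] (h : (killingForm K L).Nondegenerate) (x : L) :
    LinearMap.trace K L (LieAlgebra.ad K L x) = 0 := by
  let e := LinearMap.BilinForm.toDual (killingForm K L) h
  have h1 : e.conj (LieAlgebra.ad K L x) =
      (-1 : K) • Module.Dual.transpose (R := K) (LieAlgebra.ad K L x) := by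
    ext φ z
    obtain ⟨y, rfl⟩ := e.surjective φ
    have h2 : killingForm K L ⁅x, y⁆ z = - killingForm K L y ⁅x, z⁆ := by
      rw [← lie_skew, map_neg, LinearMap.neg_apply, LieModule.traceForm_apply_lie_apply]
    simpa [e, LinearEquiv.conj_apply, LinearMap.BilinForm.toDual_def, Module.Dual.transpose_apply] using h2
  have h3 := LinearMap.trace_conj' (LieAlgebra.ad K L x) e
  rw [h1, map_smul, LinearMap.trace_transpose', neg_one_smul] at h3
  exact self_eq_neg.1 h3.symm

variable {ι : Type*} [Fintype ι] [DecidableEq ι]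

/-- The contraction of T with the inverse of B is the trace tr(B⁻¹Tᵀ). Under a change of basis P the
factors of P cancel by cyclicity of the trace. -/
theorem sum_toMatrix_inv_mul_eq {R M : Type*} [Field R] [AddCommGroup M] [Module R M]
    (e e' : Module.Basis ι R M) (B T : LinearMap.BilinForm R M) :
    ∑ a, ∑ b, (LinearMap.BilinForm.toMatrix e B)⁻¹ a b * T (e a) (e b) =
      ∑ a, ∑ b, (LinearMap.BilinForm.toMatrix e' B)⁻¹ a b * T (e' a) (e' b) := by
  have key : ∀ b : Module.Basis ι R M,
      ∑ i, ∑ j, (LinearMap.BilinForm.toMatrix b B)⁻¹ i j * T (b i) (b j) =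
      ((LinearMap.BilinForm.toMatrix b B)⁻¹ * (LinearMap.BilinForm.toMatrix b T)ᵀ).trace := by
    intro b
    simp [Matrix.trace, Matrix.mul_apply, LinearMap.BilinForm.toMatrix_apply]
  rw [key, key]
  set P := e.toMatrix e' with hP
  have hPu : IsUnit P.det := by
    have := Module.Basis.toMatrix_mul_toMatrix_flip e e'
    exact Matrix.isUnit_det_of_right_inverse this
  rw [← LinearMap.BilinForm.toMatrix_mul_basis_toMatrix e e' B,
    ← LinearMap.BilinForm.toMatrix_mul_basis_toMatrix e e' T, ← hP]
  have hPt : IsUnit (Pᵀ).det := by rwa [Matrix.det_transpose]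
  simp only [Matrix.mul_inv_rev, Matrix.transpose_mul, Matrix.transpose_transpose,
    Matrix.mul_assoc]
  rw [← Matrix.mul_assoc (Pᵀ)⁻¹ Pᵀ, Matrix.nonsing_inv_mul _ hPt, Matrix.one_mul,
    Matrix.trace_mul_comm P⁻¹, Matrix.mul_assoc, Matrix.mul_assoc]
  rw [Matrix.mul_nonsing_inv _ hPu, Matrix.mul_one]

variable {L : Type*} [LieRing L] [LieAlgebra ℝ L] {M : Type*} [LieRing M] [LieAlgebra ℂ M]

/-- Since d preserves brackets and maps e to e', the matrices of ad in e' are those in e, with the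
same real entries; traces of their products agree. -/
theorem toMatrix_killingForm_complexification (e : Module.Basis ι ℝ L) (e' : Module.Basis ι ℂ M)
    (d : L → M) (hd : ∀ v, d v = ∑ a, (e.repr v a : ℂ) • e' a) (hd' : ∀ v w, d ⁅v, w⁆ = ⁅d v, d w⁆) :
    LinearMap.BilinForm.toMatrix e' (killingForm ℂ M) =
      (LinearMap.BilinForm.toMatrix e (killingForm ℝ L)).map Complex.ofRealHom := by
  have hde : ∀ a, d (e a) = e' a := by
    intro a
    rw [hd]
    simp [Finsupp.single_apply]
  have had : ∀ a, LinearMap.toMatrix e' e' (LieAlgebra.ad ℂ M (e' a)) =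
      (LinearMap.toMatrix e e (LieAlgebra.ad ℝ L (e a))).map Complex.ofRealHom := by
    intro a
    ext i c
    rw [Matrix.map_apply, LinearMap.toMatrix_apply, LinearMap.toMatrix_apply, LieAlgebra.ad_apply,
      LieAlgebra.ad_apply, ← hde a, ← hde c, ← hd', hd,
      Module.Basis.repr_sum_self]
    rfl
  ext a b
  rw [Matrix.map_apply, LinearMap.BilinForm.toMatrix_apply, LinearMap.BilinForm.toMatrix_apply,
    killingForm_apply_apply, killingForm_apply_apply, LinearMap.trace_eq_matrix_trace ℂ e',
    LinearMap.trace_eq_matrix_trace ℝ e, LinearMap.toMatrix_comp e' e' e',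
    LinearMap.toMatrix_comp e e e, had, had, ← Matrix.map_mul]
  exact (AddMonoidHom.map_trace Complex.ofRealHom.toAddMonoidHom _).symm

theorem _root_.Matrix.map_ofReal_inv {A : Matrix ι ι ℝ} (h : A.det ≠ 0) :
    (A.map Complex.ofRealHom)⁻¹ = A⁻¹.map Complex.ofRealHom := by
  refine Matrix.inv_eq_right_inv ?_
  rw [← Matrix.map_mul, Matrix.mul_nonsing_inv _ (isUnit_iff_ne_zero.2 h)]
  simp

theorem nondegenerate_killingForm_complexification_iff (e : Module.Basis ι ℝ L) (e' : Module.Basis ι ℂ M)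
    (d : L → M) (hd : ∀ v, d v = ∑ a, (e.repr v a : ℂ) • e' a)
    (hd' : ∀ v w, d ⁅v, w⁆ = ⁅d v, d w⁆) :
    (killingForm ℂ M).Nondegenerate ↔ (killingForm ℝ L).Nondegenerate := by
  rw [LinearMap.BilinForm.nondegenerate_iff_det_ne_zero e,
    LinearMap.BilinForm.nondegenerate_iff_det_ne_zero e',
    toMatrix_killingForm_complexification e e' d hd hd']
  have := RingHom.map_det Complex.ofRealHom (LinearMap.BilinForm.toMatrix e (killingForm ℝ L))
  rw [RingHom.mapMatrix_apply] at this
  rw [← this]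
  simp

end KillingForm

/-! ### The holomorphic Casimir operator and its restriction to real subgroups -/

section Casimir

variable {n : ℕ}
  {G : Type*} [TopologicalSpace G] [ChartedSpace (EuclideanSpace ℝ (Fin n)) G] [Group G]
  {GC : Type*} [TopologicalSpace GC] [ChartedSpace (EuclideanSpace ℂ (Fin n)) GC] [Group GC]

local notation "E" => EuclideanSpace ℂ (Fin n)

theorem lieDifferential_eq_sum (φ : G →* GC) (v : GroupLieAlgebra (𝓡 n) G) :
    lieDifferential (n := n) φ v = ∑ a, ((lieBasis ℝ n G).repr v a : ℂ) •
      lieDifferential (n := n) φ (lieBasis ℝ n G a) := by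
  conv_lhs => rw [← (lieBasis ℝ n G).sum_repr v]
  refine (map_sum (mfderiv (𝓡 n) 𝓘(ℝ, E) φ 1) _ _).trans ?_
  refine Finset.sum_congr rfl fun a _ => ?_
  refine (map_smul (mfderiv (𝓡 n) 𝓘(ℝ, E) φ 1) _ _).trans ?_
  exact (Complex.coe_smul _ (show E from _)).symm

theorem exists_basis_eq_lieDifferential (φ : G →* GC)
    (hspan : Submodule.span ℂ (Set.range (lieDifferential (n := n) φ)) = ⊤) :
    ∃ e' : Module.Basis (Fin n) ℂ (GroupLieAlgebra 𝓘(ℂ, E) GC),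
      ∀ a, e' a = lieDifferential (n := n) φ (lieBasis ℝ n G a) := by
  have h1 : ⊤ ≤ Submodule.span ℂ
      (Set.range fun a => lieDifferential (n := n) φ (lieBasis ℝ n G a)) := by
    rw [← hspan, Submodule.span_le]
    rintro _ ⟨v, rfl⟩
    rw [lieDifferential_eq_sum]
    exact Submodule.sum_mem _ fun a _ =>
      Submodule.smul_mem _ _ (Submodule.subset_span ⟨a, rfl⟩)
  have h2 : Fintype.card (Fin n) = Module.finrank ℂ (GroupLieAlgebra 𝓘(ℂ, E) GC) :=
    (Module.finrank_eq_card_basis (lieBasis ℂ n GC)).symm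
  exact ⟨basisOfTopLeSpanOfCardEqFinrank _ h1 h2, fun a => by simp⟩

variable [LieGroup 𝓘(ℂ, EuclideanSpace ℂ (Fin n)) ω GC]

/-- The second-order left-invariant operator attached to the inverse of the Killing form. -/
noncomputable def casimir (F : GC → ℂ) (z : GC) : ℂ :=
  ∑ a, ∑ b, (LinearMap.BilinForm.toMatrix (lieBasis ℂ n GC)
    (killingForm ℂ (GroupLieAlgebra 𝓘(ℂ, E) GC)))⁻¹ a b *
      invDeriv (lieBasis ℂ n GC b) (invDeriv (lieBasis ℂ n GC a) F) z

theorem contMDiffAt_casimir {F : GC → ℂ} {z : GC} (hF : ContMDiffAt 𝓘(ℂ, E) 𝓘(ℂ) ω F z) :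
    ContMDiffAt 𝓘(ℂ, E) 𝓘(ℂ) ω (casimir (n := n) F) z := by
  refine ContMDiffAt.sum fun a _ => ContMDiffAt.sum fun b _ => ?_
  exact contMDiffAt_const.mul (contMDiffAt_invDeriv (contMDiffAt_invDeriv hF _) _)

theorem casimir_congr {F₁ F₂ : GC → ℂ} {z : GC} (h : F₁ =ᶠ[𝓝 z] F₂) :
    casimir (n := n) F₁ z = casimir (n := n) F₂ z := by
  refine Finset.sum_congr rfl fun a _ => Finset.sum_congr rfl fun b _ => ?_
  congr 1
  refine invDeriv_congr ?_
  filter_upwards [h.eventuallyEq_nhds] with y hy using invDeriv_congr hy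

theorem casimir_const_mul {F : GC → ℂ} {z : GC} (hF : ContMDiffAt 𝓘(ℂ, E) 𝓘(ℂ) ω F z) (c : ℂ) :
    casimir (n := n) (fun y => c * F y) z = c * casimir (n := n) F z := by
  have h1 : ∀ (v : GroupLieAlgebra 𝓘(ℂ, E) GC) (F : GC → ℂ) (y : GC),
      ContMDiffAt 𝓘(ℂ, E) 𝓘(ℂ) ω F y → invDeriv v (fun x => c * F x) y = c * invDeriv v F y := by
    intro v F y hF
    have := invDeriv_fun_sum_smul (Finset.univ : Finset Unit) (fun _ => c) v (fun _ => F) y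
      fun _ _ => hF
    simpa using this
  simp only [casimir, Finset.mul_sum]
  refine Finset.sum_congr rfl fun a _ => Finset.sum_congr rfl fun b _ => ?_
  rw [mul_left_comm, ← h1 _ _ _ (contMDiffAt_invDeriv hF _)]
  congr 1
  refine invDeriv_congr ?_
  filter_upwards [(contMDiffAt_iff_contMDiffAt_nhds (by simp)).1 hF] with y hy using h1 _ _ _ hy

/-- Basis independence allows `casimir` to be computed in the image of a real basis of 𝔤 or of 𝔲. It
is a contraction of the bilinear form T(v, w) = w(v F); linearity in v needs F smooth. -/
theorem casimir_eq_sum_basis {F : GC → ℂ} {z : GC} (hF : ContMDiffAt 𝓘(ℂ, E) 𝓘(ℂ) ω F z)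
    (e : Module.Basis (Fin n) ℂ (GroupLieAlgebra 𝓘(ℂ, E) GC)) :
    casimir (n := n) F z = ∑ a, ∑ b, (LinearMap.BilinForm.toMatrix e
      (killingForm ℂ (GroupLieAlgebra 𝓘(ℂ, E) GC)))⁻¹ a b *
        invDeriv (e b) (invDeriv (e a) F) z := by
  let T : LinearMap.BilinForm ℂ (GroupLieAlgebra 𝓘(ℂ, E) GC) := LinearMap.mk₂ ℂ
    (fun v w => invDeriv w (invDeriv v F) z) ?_ ?_ ?_ ?_
  · exact sum_toMatrix_inv_mul_eq (lieBasis ℂ n GC) e _ T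
  · intro v v' w
    have h1 : invDeriv (v + v') F = fun y => ∑ i : Fin 2, (1 : ℂ) • invDeriv (![v, v'] i) F y := by
      ext y
      have := invDeriv_sum_smul (Finset.univ : Finset (Fin 2)) (fun _ => (1 : ℂ)) ![v, v'] F y
      simpa [Fin.sum_univ_two] using this
    rw [h1, invDeriv_fun_sum_smul _ _ _ _ _ fun i _ => contMDiffAt_invDeriv hF _]
    simp [Fin.sum_univ_two]
  · intro c v w
    have h1 : invDeriv (c • v) F = fun y => ∑ i : Fin 1, c • invDeriv v F y := by
      ext y
      simp [invDeriv_smul_left]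
    rw [h1, invDeriv_fun_sum_smul _ _ _ _ _ fun i _ => contMDiffAt_invDeriv hF _]
    simp
  · intro v w w'
    exact map_add (mfderiv 𝓘(ℂ, E) 𝓘(ℂ) (fun h => invDeriv v F (z * h)) 1) w w'
  · intro c v w
    exact invDeriv_smul_left c w _ z

variable [LieGroup (𝓡 n) ω G]

theorem IsLieSubgroup.killingForm_nondegenerate_iff {φ : G →* GC} (hφ : IsLieSubgroup (n := n) φ)
    (hspan : Submodule.span ℂ (Set.range (lieDifferential (n := n) φ)) = ⊤) :
    (killingForm ℂ (GroupLieAlgebra 𝓘(ℂ, E) GC)).Nondegenerate ↔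
      (killingForm ℝ (GroupLieAlgebra (𝓡 n) G)).Nondegenerate := by
  obtain ⟨e', he'⟩ := exists_basis_eq_lieDifferential φ hspan
  refine nondegenerate_killingForm_complexification_iff (lieBasis ℝ n G) e' (lieDifferential (n := n) φ) ?_
    hφ.lieDifferential_lie
  intro v
  simp only [he']
  exact lieDifferential_eq_sum φ v

/-- In the basis e' both operators have the same real coefficients and the same invariant
derivatives. The factor α⁻¹ comes from inverting the matrix of α times the Killing form. -/
theorem IsLieSubgroup.tension_eq_casimir {φ : G →* GC} (hφ : IsLieSubgroup (n := n) φ)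
    (hspan : Submodule.span ℂ (Set.range (lieDifferential (n := n) φ)) = ⊤)
    (hnd : (killingForm ℝ (GroupLieAlgebra (𝓡 n) G)).Nondegenerate) {α : ℝ} (hα : α ≠ 0)
    {F : GC → ℂ} {g : G} (hF : ContMDiffAt 𝓘(ℂ, E) 𝓘(ℂ) ω F (φ g)) {f : G → ℂ}
    (hf : f =ᶠ[𝓝 g] F ∘ φ) :
    tension (leftInvariantMetric (α • killingForm ℝ (GroupLieAlgebra (𝓡 n) G))) f g =
      (α : ℂ)⁻¹ * casimir (n := n) F (φ g) := by
  obtain ⟨e', he'⟩ := exists_basis_eq_lieDifferential φ hspan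
  set κ := killingForm ℝ (GroupLieAlgebra (𝓡 n) G)
  have hdet : (LinearMap.BilinForm.toMatrix (lieBasis ℝ n G) κ).det ≠ 0 :=
    (LinearMap.BilinForm.nondegenerate_iff_det_ne_zero _).1 hnd
  have hdet' : (LinearMap.BilinForm.toMatrix (lieBasis ℝ n G) (α • κ)).det ≠ 0 := by
    rw [map_smul, Matrix.det_smul]
    exact mul_ne_zero (pow_ne_zero _ hα) hdet
  have htr : ∀ v : GroupLieAlgebra (𝓡 n) G,
      ∑ c, (lieBasis ℝ n G).repr ⁅v, lieBasis ℝ n G c⁆ c = 0 := by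
    intro v
    have : Module.Finite ℝ (GroupLieAlgebra (𝓡 n) G) := Module.Finite.of_basis (lieBasis ℝ n G)
    have h1 := trace_ad_eq_zero hnd v
    rw [LinearMap.trace_eq_matrix_trace ℝ (lieBasis ℝ n G)] at h1
    simpa [Matrix.trace, LinearMap.toMatrix_apply] using h1
  have hfs : ContMDiffAt (𝓡 n) 𝓘(ℝ, ℂ) ω f g := (hφ.contMDiffAt_comp hF).congr_of_eventuallyEq hf
  have hFn := hφ.contMDiff.continuous.continuousAt.eventually
    ((contMDiffAt_iff_contMDiffAt_nhds (by simp)).1 hF)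
  have hD : ∀ a b, invDeriv (lieBasis ℝ n G b) (invDeriv (lieBasis ℝ n G a) f) g =
      invDeriv (e' b) (invDeriv (e' a) F) (φ g) := by
    intro a b
    rw [he', he', ← hφ.invDeriv_comp (contMDiffAt_invDeriv hF _)]
    refine invDeriv_congr ?_
    filter_upwards [hf.eventuallyEq_nhds, hFn] with y hy hy2
    rw [invDeriv_congr hy, hφ.invDeriv_comp hy2]
    rfl
  rw [tension_leftInvariantMetric _ hdet' htr hfs, casimir_eq_sum_basis hF e',
    toMatrix_killingForm_complexification (lieBasis ℝ n G) e' (lieDifferential (n := n) φ)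
      (by simpa only [he'] using lieDifferential_eq_sum φ) hφ.lieDifferential_lie,
    Matrix.map_ofReal_inv hdet, map_smul, Finset.mul_sum]
  have hinv : (α • LinearMap.BilinForm.toMatrix (lieBasis ℝ n G) κ)⁻¹ =
      α⁻¹ • (LinearMap.BilinForm.toMatrix (lieBasis ℝ n G) κ)⁻¹ := by
    refine Matrix.inv_eq_right_inv ?_
    rw [Matrix.smul_mul, Matrix.mul_smul, smul_smul, mul_inv_cancel₀ hα, one_smul,
      Matrix.mul_nonsing_inv _ (isUnit_iff_ne_zero.2 hdet)]
  rw [hinv]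
  refine Finset.sum_congr rfl fun a _ => ?_
  rw [Finset.mul_sum]
  refine Finset.sum_congr rfl fun b _ => ?_
  rw [hD, Matrix.smul_apply, Matrix.map_apply, Complex.real_smul]
  simp [mul_assoc]

end Casimir

/-! ### Spanning by both real forms, iterates, and transfer of proper harmonicity -/

section ProperHarmonic

variable {n : ℕ}
  {G : Type*} [TopologicalSpace G] [ChartedSpace (EuclideanSpace ℝ (Fin n)) G] [Group G]
  {GC : Type*} [TopologicalSpace GC] [ChartedSpace (EuclideanSpace ℂ (Fin n)) GC] [Group GC]

local notation "E" => EuclideanSpace ℂ (Fin n)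

theorem IsComplexification.span_eq_top {ι : G →* GC} (hι : IsComplexification (n := n) ι) :
    Submodule.span ℂ (Set.range (lieDifferential (n := n) ι)) = ⊤ := by
  refine eq_top_iff.2 fun z _ => ?_
  obtain ⟨⟨x, y⟩, rfl⟩ := hι.bijective.2 z
  exact Submodule.add_mem _ (Submodule.subset_span ⟨x, rfl⟩)
    (Submodule.smul_mem _ _ (Submodule.subset_span ⟨y, rfl⟩))

theorem IsDualSubgroup.span_eq_top [LieGroup (𝓡 n) ω G]
    {U : Type*} [TopologicalSpace U] [ChartedSpace (EuclideanSpace ℝ (Fin n)) U] [Group U]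
    {k : LieSubalgebra ℝ (GroupLieAlgebra (𝓡 n) G)}
    {p : Submodule ℝ (GroupLieAlgebra (𝓡 n) G)} (hkp : IsCompl k.toSubmodule p)
    {ι : G →* GC} (hι : IsComplexification (n := n) ι) {j : U →* GC}
    (hj : IsDualSubgroup (n := n) ι k p j) :
    Submodule.span ℂ (Set.range (lieDifferential (n := n) j)) = ⊤ := by
  refine eq_top_iff.2 ?_
  rw [← hι.span_eq_top, Submodule.span_le]
  rintro _ ⟨v, rfl⟩
  have h0 : lieDifferential (n := n) ι 0 = 0 := map_zero (mfderiv (𝓡 n) 𝓘(ℝ, E) ι 1)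
  have hk : ∀ x ∈ k, lieDifferential (n := n) ι x ∈
      Submodule.span ℂ (Set.range (lieDifferential (n := n) j)) := fun x hx => by
    refine Submodule.subset_span ?_
    rw [hj.range_eq]
    exact ⟨x, hx, 0, p.zero_mem, by rw [h0, smul_zero, add_zero]⟩
  have hp : ∀ y ∈ p, lieDifferential (n := n) ι y ∈
      Submodule.span ℂ (Set.range (lieDifferential (n := n) j)) := fun y hy => by
    have h1 : Complex.I • lieDifferential (n := n) ι y ∈
        Submodule.span ℂ (Set.range (lieDifferential (n := n) j)) := by
      refine Submodule.subset_span ?_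
      rw [hj.range_eq]
      exact ⟨0, k.zero_mem, y, hy, by rw [h0, zero_add]⟩
    -- Over ℂ, 𝔭 is recovered from i𝔭 by multiplying by -i.
    have h2 := Submodule.smul_mem _ (-Complex.I) h1
    rwa [smul_smul, neg_mul, Complex.I_mul_I, neg_neg, one_smul] at h2
  obtain ⟨x, hx, y, hy, rfl⟩ := Submodule.mem_sup.1
    (hkp.sup_eq_top ▸ Submodule.mem_top : v ∈ k.toSubmodule ⊔ p)
  have hadd : lieDifferential (n := n) ι (x + y) =
      lieDifferential (n := n) ι x + lieDifferential (n := n) ι y :=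
    map_add (mfderiv (𝓡 n) 𝓘(ℝ, E) ι 1) x y
  rw [hadd]
  exact Submodule.add_mem _ (hk x hx) (hp y hy)

variable [LieGroup 𝓘(ℂ, EuclideanSpace ℂ (Fin n)) ω GC]

theorem contMDiffOn_iterate_casimir (α : ℂ) {WC : Set GC} (hWC : IsOpen WC) {F : GC → ℂ}
    (hF : ContMDiffOn 𝓘(ℂ, E) 𝓘(ℂ) ω F WC) (r : ℕ) :
    ContMDiffOn 𝓘(ℂ, E) 𝓘(ℂ) ω ((fun H z => α * casimir (n := n) H z)^[r] F) WC := by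
  induction r with
  | zero => exact hF
  | succ r ih =>
    rw [Function.iterate_succ_apply']
    intro z hz
    exact (contMDiffAt_const.mul
      (contMDiffAt_casimir (ih.contMDiffAt (hWC.mem_nhds hz)))).contMDiffWithinAt

theorem iterate_casimir_eq_pow_mul (α : ℂ) {WC : Set GC} (hWC : IsOpen WC) {F : GC → ℂ}
    (hF : ContMDiffOn 𝓘(ℂ, E) 𝓘(ℂ) ω F WC) (r : ℕ) :
    ∀ z ∈ WC, (fun H z => α * casimir (n := n) H z)^[r] F z =
      α ^ r * (casimir (n := n))^[r] F z := by
  induction r with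
  | zero => simp
  | succ r ih =>
    intro z hz
    have h1 := contMDiffOn_iterate_casimir (n := n) 1 hWC hF r
    simp only [one_mul] at h1
    rw [Function.iterate_succ_apply', Function.iterate_succ_apply', pow_succ', mul_assoc,
      ← casimir_const_mul (h1.contMDiffAt (hWC.mem_nhds hz))]
    congr 1
    refine casimir_congr ?_
    filter_upwards [hWC.mem_nhds hz] with y hy using ih y hy

variable [LieGroup (𝓡 n) ω G]

theorem IsLieSubgroup.iterate_tension_eq {φ : G →* GC} (hφ : IsLieSubgroup (n := n) φ)
    (hspan : Submodule.span ℂ (Set.range (lieDifferential (n := n) φ)) = ⊤)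
    (hnd : (killingForm ℝ (GroupLieAlgebra (𝓡 n) G)).Nondegenerate) {α : ℝ} (hα : α ≠ 0)
    {WC : Set GC} (hWC : IsOpen WC) {F : GC → ℂ} (hF : ContMDiffOn 𝓘(ℂ, E) 𝓘(ℂ) ω F WC)
    {W : Set G} (hW : IsOpen W) (hsub : W ⊆ φ ⁻¹' WC) {f : G → ℂ} (hf : ∀ x ∈ W, f x = F (φ x))
    (r : ℕ) : ∀ x ∈ W,
      (tension (leftInvariantMetric (α • killingForm ℝ (GroupLieAlgebra (𝓡 n) G))))^[r] f x =
        (fun H z => (α : ℂ)⁻¹ * casimir (n := n) H z)^[r] F (φ x) := by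
  induction r with
  | zero => exact hf
  | succ r ih =>
    intro x hx
    rw [Function.iterate_succ_apply', Function.iterate_succ_apply']
    refine hφ.tension_eq_casimir hspan hnd hα
      ((contMDiffOn_iterate_casimir _ hWC hF r).contMDiffAt (hWC.mem_nhds (hsub hx))) ?_
    filter_upwards [hW.mem_nhds hx] with y hy using ih y hy

/-- The right side no longer mentions the real group or the metric, so it serves as the common
ground between G and U. -/
theorem IsLieSubgroup.isProperHarmonicOn_iff {φ : G →* GC} (hφ : IsLieSubgroup (n := n) φ)
    (hspan : Submodule.span ℂ (Set.range (lieDifferential (n := n) φ)) = ⊤)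
    (hnd : (killingForm ℝ (GroupLieAlgebra (𝓡 n) G)).Nondegenerate) {α : ℝ} (hα : α ≠ 0)
    {WC : Set GC} (hWC : IsOpen WC) {F : GC → ℂ} (hF : ContMDiffOn 𝓘(ℂ, E) 𝓘(ℂ) ω F WC)
    {W : Set G} (hW : IsOpen W) (hsub : W ⊆ φ ⁻¹' WC) {f : G → ℂ} (hf : ∀ x ∈ W, f x = F (φ x))
    (hmeet : ∀ z ∈ WC, (connectedComponentIn WC z ∩ φ '' W).Nonempty) (r : ℕ) :
    IsProperHarmonicOn (leftInvariantMetric (α • killingForm ℝ (GroupLieAlgebra (𝓡 n) G))) r f W ↔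
      (∀ z ∈ WC, (casimir (n := n))^[r] F z = 0) ∧
        ∃ z ∈ WC, (casimir (n := n))^[r - 1] F z ≠ 0 := by
  -- Vanishing of the s-th iterate transfers both ways by the identity theorem; taking s = r, and
  -- negating the case s = r - 1, gives the two halves of properness.
  have key : ∀ s : ℕ, (∀ x ∈ W,
      (tension (leftInvariantMetric (α • killingForm ℝ (GroupLieAlgebra (𝓡 n) G))))^[s] f x = 0) ↔
        ∀ z ∈ WC, (casimir (n := n))^[s] F z = 0 := by
    intro s
    have h1 : ∀ x ∈ W,
        (tension (leftInvariantMetric (α • killingForm ℝ (GroupLieAlgebra (𝓡 n) G))))^[s] f x =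
          (α : ℂ)⁻¹ ^ s * (casimir (n := n))^[s] F (φ x) := fun x hx => by
      rw [hφ.iterate_tension_eq hspan hnd hα hWC hF hW hsub hf s x hx,
        iterate_casimir_eq_pow_mul _ hWC hF s _ (hsub hx)]
    have h2 : (α : ℂ)⁻¹ ^ s ≠ 0 := pow_ne_zero _ (inv_ne_zero (Complex.ofReal_ne_zero.2 hα))
    have h3 := contMDiffOn_iterate_casimir (n := n) 1 hWC hF s
    simp only [one_mul] at h3
    constructor
    · intro h
      refine hφ.eqOn_zero hspan hW hWC hsub hmeet h3 fun x hx => ?_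
      have := h x hx
      rw [h1 x hx] at this
      exact (mul_eq_zero.1 this).resolve_left h2
    · intro h x hx
      rw [h1 x hx, h _ (hsub hx), mul_zero]
  refine and_congr (key r) ?_
  have := not_congr (key (r - 1))
  push Not at this
  exact this

end ProperHarmonic

end Duality

/-! ### The duality principle -/

theorem mainTheorem5 {n : ℕ}
    {G : Type*} [TopologicalSpace G] [ChartedSpace (EuclideanSpace ℝ (Fin n)) G] [Group G]
    [LieGroup (𝓡 n) ω G] [NoncompactSpace G]
    [LieAlgebra.IsSemisimple ℝ (GroupLieAlgebra (𝓡 n) G)]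
    {GC : Type*} [TopologicalSpace GC] [ChartedSpace (EuclideanSpace ℂ (Fin n)) GC] [Group GC]
    [LieGroup 𝓘(ℂ, EuclideanSpace ℂ (Fin n)) ω GC]
    {U : Type*} [TopologicalSpace U] [ChartedSpace (EuclideanSpace ℝ (Fin n)) U] [Group U]
    [LieGroup (𝓡 n) ω U] [CompactSpace U]
    (k : LieSubalgebra ℝ (GroupLieAlgebra (𝓡 n) G)) (p : Submodule ℝ (GroupLieAlgebra (𝓡 n) G))
    (hkp : Duality.IsCartanDecomposition k p)
    (ι : G →* GC) (hι : Duality.IsComplexification (n := n) ι)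
    (j : U →* GC) (hj : Duality.IsDualSubgroup (n := n) ι k p j)
    (c ε : ℝ) (hc : 0 < c) (hε : ε = 1 ∨ ε = -1)
    (gG : Duality.MetricField n G)
    (hgG : gG = Duality.leftInvariantMetric ((ε * c) • killingForm ℝ (GroupLieAlgebra (𝓡 n) G)))
    (gU : Duality.MetricField n U)
    (hgU : gU = Duality.leftInvariantMetric ((-c) • killingForm ℝ (GroupLieAlgebra (𝓡 n) U)))
    (W : Set G) (hW : IsOpen W) (f : G → ℂ) (hf : ContMDiffOn (𝓡 n) 𝓘(ℝ, ℂ) ω f W)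
    (WC : Set GC) (fC : GC → ℂ)
    (hfC : Duality.IsHolomorphicExtension (n := n) ι W f WC fC) :
    (∃ h : GC → ℂ,
      Duality.IsHolomorphicExtension (n := n) ι W (Duality.tension gG f) WC h ∧
        ∀ u ∈ j ⁻¹' WC, Duality.tension gU (fC ∘ j) u = -(ε : ℂ) * h (j u)) ∧
    ((∀ z ∈ WC, (connectedComponentIn WC z ∩ Set.range j).Nonempty) →
      ∀ r : ℕ, 1 ≤ r →
        (Duality.IsProperHarmonicOn gG r f W ↔
          Duality.IsProperHarmonicOn gU r (fC ∘ j) (j ⁻¹' WC))) := by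
  subst hgG hgU
  have hfin : Module.Finite ℝ (GroupLieAlgebra (𝓡 n) G) :=
    Module.Finite.of_basis (Duality.lieBasis ℝ n G)
  have hndG : (killingForm ℝ (GroupLieAlgebra (𝓡 n) G)).Nondegenerate :=
    LieAlgebra.IsKilling.killingForm_nondegenerate ℝ _
  have hsG := hι.span_eq_top
  have hsU := hj.span_eq_top hkp.isCompl hι
  -- Nondegeneracy passes from 𝔤 up to 𝔤^ℂ and down again to 𝔲.
  have hndU : (killingForm ℝ (GroupLieAlgebra (𝓡 n) U)).Nondegenerate :=
    (hj.killingForm_nondegenerate_iff hsU).1 ((hι.killingForm_nondegenerate_iff hsG).2 hndG)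
  have hε0 : ε ≠ 0 := by rcases hε with rfl | rfl <;> norm_num
  have hα : ε * c ≠ 0 := mul_ne_zero hε0 hc.ne'
  have hc' : -c ≠ 0 := neg_ne_zero.2 hc.ne'
  have hjW : IsOpen (j ⁻¹' WC) := hfC.isOpen.preimage hj.contMDiff.continuous
  refine ⟨⟨fun z => ((ε * c : ℝ) : ℂ)⁻¹ * Duality.casimir (n := n) fC z,
    ⟨hfC.isOpen, hfC.subset, hfC.component_meets, ?_, ?_⟩, ?_⟩, ?_⟩
  -- Exponent 1 in the iterate lemmas gives the statements for a single application of τ, here and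
  -- in the next two goals.
  · exact Duality.contMDiffOn_iterate_casimir (n := n) _ hfC.isOpen hfC.holomorphic 1
  · intro x hx
    exact (hι.iterate_tension_eq hsG hndG hα hfC.isOpen hfC.holomorphic hW hfC.subset
      (fun y hy => (hfC.eq_on y hy).symm) 1 x hx).symm
  · intro u hu
    have h1 := hj.iterate_tension_eq hsU hndU hc' hfC.isOpen hfC.holomorphic hjW subset_rfl
      (f := fC ∘ j) (fun _ _ => rfl) 1 u hu
    refine Eq.trans h1 ?_
    -- As ε = ±1, ε⁻¹ = ε and so -ε (εc)⁻¹ = -c⁻¹.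
    have h2 : ((-c : ℝ) : ℂ)⁻¹ = -(ε : ℂ) * ((ε * c : ℝ) : ℂ)⁻¹ := by
      rcases hε with rfl | rfl <;> simp [inv_neg]
    simp only [Function.iterate_one, h2, mul_assoc]
  · intro hmeet r _
    rw [hι.isProperHarmonicOn_iff hsG hndG hα hfC.isOpen hfC.holomorphic hW hfC.subset
        (fun y hy => (hfC.eq_on y hy).symm) hfC.component_meets r,
      hj.isProperHarmonicOn_iff hsU hndU hc' hfC.isOpen hfC.holomorphic hjW subset_rfl
        (f := fC ∘ j) (fun _ _ => rfl) ?_ r]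
    -- A point of U in the component of z lies in W^ℂ, hence in W^*; meeting U is thus the same as
    -- meeting W^*.
    intro z hz
    obtain ⟨_, hC, u, rfl⟩ := hmeet z hz
    exact ⟨j u, hC, u, connectedComponentIn_subset WC z hC, rfl⟩
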